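/- A monoid $M$ is \emph{pre-rational} if for every finite alphabet $A$, every morphism $\mu\colon A^*\to M$ and every $m\in M$, the language $\mu^{-1}(m)\subseteq A^*$ is rational. A semiring $\mathbb{K}$ is \emph{rationally additive} if it is equipped with a partial sum operator on countable families such that: (1) finite sums exist and are the usual ones; (2) $\sum_{n\ge 0}\alpha^n$ exists for every $\alpha\in\mathbb{K}$; (3) if $\sum_{i}\alpha_i$ exists then so do $\sum_i\beta\alpha_i=\beta\sum_i\alpha_i$ and $\sum_i\alpha_i\beta=(\sum_i\alpha_i)\beta$; and, whenever $I$ is the disjoint union of countably many $(I_j)_{j\in J}$ and $r_j=\sum_{i\in I_j}\alpha_i$ exists for all $j\in J$: (4) if $r=\sum_{j\in J}r_j$ exists, then $\sum_{i\in I}\alpha_i$ exists and equals $r$; (5) if $s=\sum_{i\in I}\alpha_i$ exists, then $\sum_{j\in J}r_j$ exists and equals $s$. (A sum with an arbitrary index set is understood to exist when the support of the family is countable and the sum over the support exists.) A \emph{$\mathbb{K}$-automaton over $M$} is $\mathcal{A}=(Q,I,\Delta,F)$ with $Q$ a finite set of states, $I,F\subseteq Q$, and $\Delta\subseteq Q\times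 M\times\mathbb{K}\times Q$ finite. An accepting run is a nonempty sequence of consecutive transitions starting in $I$ and ending in $F$; its label is the product in $M$ of its labels and its weight the product in $\mathbb{K}$ of its weights. The semantics of $\mathcal{A}$ is the series $M\to\mathbb{K}$ that maps $m$ to the sum of the weights of all accepting runs labelled by $m$, if these sums exist for all $m$. \emph{$\mathbb{K}$-expressions over $M$} are given by $W::=k\mid m\mid W+W\mid W\cdot W\mid W^*$ ($k\in\mathbb{K}$, $m\in M$). Their semantics is defined inductively, if all the sums below exist: $[\![k]\!]$ maps $\epsilon_M$ to $k$ and other elements to $0$; $[\![m]\!]$ is the characteristic series of $m$; $[\![U+V]\!]=[\![U]\!]+[\![V]\!]$; $[\![U\cdot V]\!](m)=\sum_{m_1m_2=m}[\![U]\!](m_1)\times[\![V]\!](m_2)$; $[\![W^*]\!](m)=\sum_{n=0}^{\infty}[\![W^n]\!](m)$, where $W^0=1$ and $W^{n+1}=W\cdot W^n$. \textbf{Theorem.} Let $\mathbb{K}$ be a rationally additive semiring, $M$ a pre-rational monoid, and $s\colon M\to\mathbb{K}$ a series. Then $s$ is the semantics of some $\mathbb{K}$-automaton over $M$ if and only if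 it is the semantics of some $\mathbb{K}$-expression over $M$. Moreover, both translations are constructive, in the following sense. Represent weights and labels by natural numbers through maps $\kappa\colon\mathbb{N}\to\mathbb{K}$ and $\mu\colon\mathbb{N}\to M$ with $\kappa(0)=0$, $\kappa(1)=1$, $\mu(0)=\epsilon_M$, so that automata are presented by finite lists of numbers and expressions by expressions with numbers as atoms. There are two computable functions, independent of $\mathbb{K}$, $M$, $\kappa$ and $\mu$: one maps every presentation of an automaton, in which distinct entries of the list of transitions represent distinct transitions, to an expression, and the other maps every expression to a presentation of an automaton. For all such $\mathbb{K},M,\kappa,\mu$, each series is the semantics of the input if and only if it is the semantics of the output. -/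

import Mathlib

universe u v

/-- A monoid `M` is pre-rational if, for every finite alphabet `A` and every monoid morphism
`μ : A* → M`, each preimage `μ⁻¹(m)` is a rational (i.e. regular) language over `A`. -/
def PreRational (M : Type*) [Monoid M] : Prop :=
  ∀ (A : Type) [Finite A] (μ : FreeMonoid A →* M) (m : M),
    Language.IsRegular ({w : List A | μ (FreeMonoid.ofList w) = m} : Language A)

/-- A rationally additive semiring: a semiring with a partial sum operator on countable families.
`a ∈ csum α` means that the sum of the family `α` exists and is equal to `a`. A partition
`I = ⨆ j, I j` indexed by `J` is given by the map `f : I → J` sending `i` to the index of its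
part. Index sets are taken in `Type`, where every countable set has a copy. -/
class RationallyAdditive (K : Type*) [Semiring K] where
  csum : ∀ {I : Type} [Countable I], (I → K) → Part K
  csum_fintype : ∀ {I : Type} [Fintype I] (α : I → K), (∑ i, α i) ∈ csum α
  csum_geometric : ∀ a : K, (csum fun n : ℕ => a ^ n).Dom
  csum_mul_left : ∀ {I : Type} [Countable I] (α : I → K) (a b : K),
    a ∈ csum α → b * a ∈ csum fun i => b * α i
  csum_mul_right : ∀ {I : Type} [Countable I] (α : I → K) (a b : K),
    a ∈ csum α → a * b ∈ csum fun i => α i * b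
  csum_of_parts : ∀ {I J : Type} [Countable I] [Countable J] (f : I → J) (α : I → K)
    (r : J → K) (s : K),
    (∀ j, r j ∈ csum fun i : {i : I // f i = j} => α i.1) → s ∈ csum r → s ∈ csum α
  csum_parts : ∀ {I J : Type} [Countable I] [Countable J] (f : I → J) (α : I → K)
    (r : J → K) (s : K),
    s ∈ csum α → (∀ j, r j ∈ csum fun i : {i : I // f i = j} => α i.1) → s ∈ csum r

/-- The sum `∑ i, α i` exists and is equal to `a`, for an index set `ι` of any size, in any
universe: the support of `α` is countable, and the sum of `α` over its support (enumerated by a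
countable `I : Type`) exists and is equal to `a`. For countable `ι` this is the sum of the
family `α` itself, because zero terms and bijective reindexing do not affect sums in a
rationally additive semiring. -/
def IsCountableSum {K : Type*} [Semiring K] [RationallyAdditive K] {ι : Type*}
    (α : ι → K) (a : K) : Prop :=
  ∃ (I : Type) (_ : Countable I) (e : I ≃ Function.support α),
    a ∈ RationallyAdditive.csum fun i => α (e i)

/-- A `K`-automaton over `M` with finite set of states `Q`. A transition `(p, m, k, q)` goes from
`p` to `q`, with label `m` and weight `k`. -/
structure WAutomaton (K M Q : Type*) [Finite Q] where
  init : Set Q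
  trans : Set (Q × M × K × Q)
  final : Set Q
  trans_finite : trans.Finite

namespace WAutomaton

variable {K M Q : Type*} [Finite Q]

/-- Accepting runs: nonempty sequences of consecutive transitions of the automaton, the first
one starting in an initial state and the last one ending in a final state. -/
def IsAcceptingRun (A : WAutomaton K M Q) (w : List (Q × M × K × Q)) : Prop :=
  (∀ t ∈ w, t ∈ A.trans) ∧ w.IsChain (fun t t' => t.2.2.2 = t'.1) ∧
    (∃ t ∈ w.head?, t.1 ∈ A.init) ∧ (∃ t ∈ w.getLast?, t.2.2.2 ∈ A.final)

/-- The label of a sequence of transitions: the product in `M` of the labels. -/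
def runLabel [Monoid M] (w : List (Q × M × K × Q)) : M := (w.map fun t => t.2.1).prod

/-- The weight of a sequence of transitions: the product in `K` of the weights. -/
def runWeight [Semiring K] (w : List (Q × M × K × Q)) : K := (w.map fun t => t.2.2.1).prod

/-- The automaton is valid and its semantics is the series `s`: for every `m`, the sum of
the weights of the accepting runs labelled by `m` exists and is equal to `s m`. -/
def IsSemantics [Monoid M] [Semiring K] [RationallyAdditive K]
    (A : WAutomaton K M Q) (s : M → K) : Prop :=
  ∀ m : M, IsCountableSum
    (fun w : {w : List (Q × M × K × Q) // A.IsAcceptingRun w ∧ runLabel w = m} =>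
      runWeight w.1) (s m)

end WAutomaton

/-- `K`-expressions over `M`: `W ::= k | m | W + W | W · W | W*`. -/
inductive WExpr (K M : Type*) where
  | weight (k : K) : WExpr K M
  | label (m : M) : WExpr K M
  | add (U V : WExpr K M) : WExpr K M
  | mul (U V : WExpr K M) : WExpr K M
  | star (U : WExpr K M) : WExpr K M

namespace WExpr

variable {K M : Type*}

/-- The expression `Wⁿ`: `W⁰ = 1` and `Wⁿ⁺¹ = W · Wⁿ`. -/
def pow [One K] (W : WExpr K M) : ℕ → WExpr K M
  | 0 => weight 1
  | n + 1 => mul W (W.pow n)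

/-- `IsSemantics W s`: the expression `W` is valid (all the sums occurring in its semantics exist)
and its semantics is the series `s`. -/
inductive IsSemantics [Monoid M] [Semiring K] [RationallyAdditive K] :
    WExpr K M → (M → K) → Prop
  | weight (k : K) : IsSemantics (weight k) (Set.indicator {1} fun _ => k)
  | label (m : M) : IsSemantics (label m) (Set.indicator {m} fun _ => 1)
  | add {U V : WExpr K M} {u v : M → K} (hU : IsSemantics U u) (hV : IsSemantics V v) :
      IsSemantics (add U V) (u + v)
  | mul {U V : WExpr K M} {u v s : M → K} (hU : IsSemantics U u) (hV : IsSemantics V v)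
      (hs : ∀ m, IsCountableSum (fun p : {p : M × M // p.1 * p.2 = m} => u p.1.1 * v p.1.2)
        (s m)) :
      IsSemantics (mul U V) s
  | star {U : WExpr K M} {p : ℕ → M → K} {s : M → K} (hU : ∀ n, IsSemantics (U.pow n) (p n))
      (hs : ∀ m, IsCountableSum (fun n => p n m) (s m)) :
      IsSemantics (star U) s

/-- Substitution of the atoms of an expression. -/
def map {K' M' : Type*} (κ : K → K') (μ : M → M') : WExpr K M → WExpr K' M'
  | weight k => weight (κ k)
  | label m => label (μ m)
  | add U V => add (U.map κ μ) (V.map κ μ)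
  | mul U V => mul (U.map κ μ) (V.map κ μ)
  | star U => star (U.map κ μ)

/-- Numerical encoding of the expressions whose atoms are represented by natural numbers. -/
def toNat : WExpr ℕ ℕ → ℕ
  | weight k => 5 * k
  | label m => 5 * m + 1
  | add U V => 5 * Nat.pair U.toNat V.toNat + 2
  | mul U V => 5 * Nat.pair U.toNat V.toNat + 3
  | star U => 5 * U.toNat + 4

theorem toNat_injective : Function.Injective toNat := by
  intro U
  induction U with
  | weight k => intro V h; cases V <;> simp only [toNat] at h <;> first | omega | (congr 1; omega)
  | label k => intro V h; cases V <;> simp only [toNat] at h <;> first | omega | (congr 1; omega)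
  | add U₁ U₂ h₁ h₂ =>
    intro V h
    cases V with
    | add V₁ V₂ =>
      simp only [toNat] at h
      have h' : Nat.pair U₁.toNat U₂.toNat = Nat.pair V₁.toNat V₂.toNat := by omega
      rw [h₁ (Nat.pair_eq_pair.1 h').1, h₂ (Nat.pair_eq_pair.1 h').2]
    | _ => simp only [toNat] at h; omega
  | mul U₁ U₂ h₁ h₂ =>
    intro V h
    cases V with
    | mul V₁ V₂ =>
      simp only [toNat] at h
      have h' : Nat.pair U₁.toNat U₂.toNat = Nat.pair V₁.toNat V₂.toNat := by omega
      rw [h₁ (Nat.pair_eq_pair.1 h').1, h₂ (Nat.pair_eq_pair.1 h').2]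
    | _ => simp only [toNat] at h; omega
  | star U hU =>
    intro V h
    cases V with
    | star V =>
      simp only [toNat] at h
      rw [hU (show U.toNat = V.toNat by omega)]
    | _ => simp only [toNat] at h; omega

theorem toNat_surjective : Function.Surjective toNat := by
  intro n
  induction n using Nat.strong_induction_on with
  | _ n ih =>
    have hn : n = 5 * (n / 5) + n % 5 := by omega
    have hl := Nat.unpair_left_le (n / 5)
    have hr := Nat.unpair_right_le (n / 5)
    have hp := Nat.pair_unpair (n / 5)
    have h5 : n % 5 = 0 ∨ n % 5 = 1 ∨ n % 5 = 2 ∨ n % 5 = 3 ∨ n % 5 = 4 := by omega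
    rcases h5 with h | h | h | h | h
    · exact ⟨weight (n / 5), by simp only [toNat]; omega⟩
    · exact ⟨label (n / 5), by simp only [toNat]; omega⟩
    · obtain ⟨U, hU⟩ := ih (n / 5).unpair.1 (by omega)
      obtain ⟨V, hV⟩ := ih (n / 5).unpair.2 (by omega)
      exact ⟨add U V, by simp only [toNat, hU, hV, hp]; omega⟩
    · obtain ⟨U, hU⟩ := ih (n / 5).unpair.1 (by omega)
      obtain ⟨V, hV⟩ := ih (n / 5).unpair.2 (by omega)
      exact ⟨mul U V, by simp only [toNat, hU, hV, hp]; omega⟩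
    · obtain ⟨U, hU⟩ := ih (n / 5) (by omega)
      exact ⟨star U, by simp only [toNat, hU]; omega⟩

/-- Expressions with atoms represented by natural numbers are data on which one can compute. -/
noncomputable instance : Primcodable (WExpr ℕ ℕ) :=
  Primcodable.ofEquiv ℕ (Equiv.ofBijective toNat ⟨toNat_injective, toNat_surjective⟩)

end WExpr

/-- Finite presentations `(n, I, Δ, F)` of automata: the number of states, the lists of initial
states, of transitions and of final states. States are the natural numbers below `n` (entries
that mention other states are ignored), and labels and weights are represented by natural
numbers. -/
abbrev AutomatonCode : Type := ℕ × List ℕ × List (ℕ × ℕ × ℕ × ℕ) × List ℕ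

namespace AutomatonCode

/-- The automaton presented by a code, when `k : ℕ` represents the weight `κ k` and `m : ℕ`
represents the label `μ m`. -/
def toAutomaton {K M : Type*} (κ : ℕ → K) (μ : ℕ → M) (c : AutomatonCode) :
    WAutomaton K M (Fin c.1) where
  init := {q | q.1 ∈ c.2.1}
  trans := {t | ∃ m k : ℕ, (t.1.1, m, k, t.2.2.2.1) ∈ c.2.2.1 ∧ t.2.1 = μ m ∧ t.2.2.1 = κ k}
  final := {q | q.1 ∈ c.2.2.2}
  trans_finite := by
    have hfin : {x : ℕ × M × K × ℕ |
        ∃ y ∈ c.2.2.1, (y.1, μ y.2.1, κ y.2.2.1, y.2.2.2) = x}.Finite :=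
      (List.finite_toSet c.2.2.1).image fun y : ℕ × ℕ × ℕ × ℕ => (y.1, μ y.2.1, κ y.2.2.1, y.2.2.2)
    refine Set.Finite.of_finite_image
      (f := fun t : Fin c.1 × M × K × Fin c.1 => (t.1.1, t.2.1, t.2.2.1, t.2.2.2.1))
      (hfin.subset ?_) ?_
    · rintro _ ⟨⟨p, _, _, q⟩, ⟨m, k, h, rfl, rfl⟩, rfl⟩
      exact ⟨_, h, rfl⟩
    · rintro ⟨p, m, k, q⟩ - ⟨p', m', k', q'⟩ - h
      simp only [Prod.mk.injEq] at h
      obtain ⟨h1, h2, h3, h4⟩ := h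
      rw [Fin.ext h1, h2, h3, Fin.ext h4]

/-- Distinct entries of the list of transitions represent distinct transitions. -/
def Faithful {K M : Type*} (κ : ℕ → K) (μ : ℕ → M) (c : AutomatonCode) : Prop :=
  Set.InjOn (fun t : ℕ × ℕ × ℕ × ℕ => (t.1, μ t.2.1, κ t.2.2.1, t.2.2.2)) {t | t ∈ c.2.2.1}

end AutomatonCode

/-!
Everything is reduced to sums over sets of words and bijections between such sets, so that no
identity between rational series has to be computed.

With atoms represented by numbers, an expression `W` has a set `WExpr.Parse W` of derivations, each
of which has a label and a weight; at a product a derivation is a pair, at a star it is a list.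
If for all expressions the weights of the derivations with a given label have a sum, then the
semantics of `W` exists and is given by these sums, by the partition axioms
(`WExpr.isSemantics_map_iff`). Likewise the semantics of an automaton is a sum over the words of
entries that form accepting runs (`WAutomaton.isSemantics_iff_hasSeries`). So an automaton and an
expression are equivalent as soon as the runs of the former are in bijection with the derivations
of the latter, with the same labels and weights (`Represents`). Two constructions provide such
bijections.

* From automata to expressions, the recursion of McNaughton and Yamada: a path that may visit the
  state `h` is uniquely decomposed at its visits to `h` (`Represents.insert`), because the
  paths to `h` that do not pass through `h` on the way are a prefix code, and the paths from `h`
  with this property are a suffix code.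
* From expressions to automata, a construction in the style of Thompson, with transitions of label
  `1` and weight `1`. State elimination at the state that joins the parts of the automaton also
  shows that its paths are the derivations (`represents_compile`).

It remains to see that the sums exist. If labels are disregarded, the weights of the derivations
of an expression have a sum by induction, as geometric sums exist
(`WExpr.exists_isCountableSum_val`). Applied to the expression of a deterministic automaton, this
shows that sums over regular languages exist (`Language.IsRegular.exists_isCountableSum`). Over a
pre-rational monoid, the accepting runs with a given label form a regular language, whence all
automata are valid (`AutomatonCode.exists_hasSeries`), and so are all expressions, by the second
construction.

Both constructions are primitive recursive: the first one fills in a table of expressions, and the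
second one is a course-of-values recursion on the encoding of expressions.
-/

/-! ### Countable sums -/

section Sums

open RationallyAdditive

variable {K : Type*} [Semiring K] [RationallyAdditive K]

theorem csum_unique {I : Type} [Countable I] {α : I → K} {a b : K} (ha : a ∈ csum α)
    (hb : b ∈ csum α) : a = b :=
  Part.mem_unique ha hb

theorem csum_of_isEmpty {I : Type} [Countable I] [IsEmpty I] (α : I → K) : (0 : K) ∈ csum α := by
  have : Fintype I := Fintype.ofIsEmpty
  simpa using csum_fintype α

theorem csum_of_unique {I : Type} [Countable I] [Unique I] (α : I → K) :
    α default ∈ csum α := by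
  simpa using csum_fintype α

theorem csum_equiv {I J : Type} [Countable I] [Countable J] (e : I ≃ J) {α : I → K} {β : J → K}
    (h : ∀ i, α i = β (e i)) {a : K} (ha : a ∈ csum β) : a ∈ csum α := by
  refine csum_of_parts e α β a (fun j => ?_) ha
  have : Unique {i : I // e i = j} :=
    ⟨⟨⟨e.symm j, by simp⟩⟩, fun i => Subtype.ext (by simp [← i.2])⟩
  have h1 := csum_of_unique fun i : {i : I // e i = j} => α i.1
  rwa [h, (default : {i : I // e i = j}).2] at h1

/-- Terms equal to zero do not affect a sum. -/
theorem csum_embedding_iff {I J : Type} [Countable I] [Countable J] {g : I → J}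
    (hg : Function.Injective g) {α : I → K} {β : J → K} (h : ∀ i, α i = β (g i))
    (h0 : ∀ j ∉ Set.range g, β j = 0) {a : K} : a ∈ csum α ↔ a ∈ csum β := by
  classical
  -- `β` is the family of the sums of `α` over the fibres of `g`
  have hfib : ∀ j, β j ∈ csum fun i : {i : I // g i = j} => α i.1 := fun j => by
    by_cases hj : j ∈ Set.range g
    · obtain ⟨i, rfl⟩ := hj
      have : Unique {i' : I // g i' = g i} := ⟨⟨⟨i, rfl⟩⟩, fun i' => Subtype.ext (hg i'.2)⟩
      have h1 := csum_of_unique fun i' : {i' : I // g i' = g i} => α i'.1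
      rwa [h, (default : {i' : I // g i' = g i}).2] at h1
    · have : IsEmpty {i : I // g i = j} := ⟨fun i => hj ⟨i.1, i.2⟩⟩
      rw [h0 j hj]
      exact csum_of_isEmpty _
  exact ⟨fun ha => csum_parts g α β a ha hfib, fun ha => csum_of_parts g α β a hfib ha⟩

/-- `IsCountableSum` may be computed along any enumeration of a set that contains the support. -/
theorem isCountableSum_iff_csum {ι : Type*} {I : Type} [Countable I] {g : I → ι}
    (hg : Function.Injective g) {α : ι → K} (h0 : ∀ j ∉ Set.range g, α j = 0) {a : K} :
    IsCountableSum α a ↔ a ∈ csum fun i => α (g i) := by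
  have key : ∀ (I' : Type) (_ : Countable I') (e : I' ≃ Function.support α),
      a ∈ csum (fun i => α (e i)) ↔ a ∈ csum fun i => α (g i) := by
    intro I' _ e
    have hr : ∀ i' : I', ∃ i, g i = e i' := fun i' => by
      by_contra hc
      exact (e i').2 (h0 _ hc)
    choose φ hφ using hr
    refine csum_embedding_iff (g := φ) (fun x y hxy => ?_) (fun i => by rw [hφ]) (fun j hj => ?_)
    · exact e.injective (Subtype.ext (by rw [← hφ, ← hφ, hxy]))
    · by_contra hc
      exact hj ⟨e.symm ⟨g j, hc⟩, hg (by rw [hφ]; simp)⟩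
  constructor
  · rintro ⟨I', hI', e, h⟩
    exact (key I' hI' e).1 h
  · intro h
    have : Function.support α ⊆ Set.range g := fun j hj => by
      by_contra hc
      exact hj (h0 j hc)
    let e : {i : I // g i ∈ Function.support α} ≃ Function.support α :=
      Equiv.ofBijective (fun i => ⟨g i.1, i.2⟩)
        ⟨fun x y hxy => Subtype.ext (hg (congrArg Subtype.val hxy)), fun j => by
          obtain ⟨i, hi⟩ := this j.2
          exact ⟨⟨i, hi ▸ j.2⟩, Subtype.ext hi⟩⟩
    exact ⟨_, inferInstance, e, (key _ inferInstance e).2 h⟩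

theorem isCountableSum_iff {I : Type} [Countable I] {α : I → K} {a : K} :
    IsCountableSum α a ↔ a ∈ csum α :=
  isCountableSum_iff_csum (g := id) Function.injective_id (by simp)

theorem IsCountableSum.unique {ι : Type*} {α : ι → K} {a b : K} (ha : IsCountableSum α a)
    (hb : IsCountableSum α b) : a = b := by
  obtain ⟨I, _, e, h⟩ := ha
  refine csum_unique h ((isCountableSum_iff_csum (g := fun i => (e i : ι))
    (Subtype.val_injective.comp e.injective) fun j hj => ?_).1 hb)
  by_contra hc
  exact hj ⟨e.symm ⟨j, hc⟩, by simp⟩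

theorem isCountableSum_embedding_iff {ι κ : Type*} {g : ι → κ} (hg : Function.Injective g)
    {α : ι → K} {β : κ → K} (h : ∀ i, α i = β (g i)) (h0 : ∀ j ∉ Set.range g, β j = 0) {a : K} :
    IsCountableSum α a ↔ IsCountableSum β a := by
  constructor
  · rintro ⟨I, _, e, ha⟩
    refine (isCountableSum_iff_csum (g := fun i => g (e i))
      (hg.comp (Subtype.val_injective.comp e.injective)) fun j hj => ?_).2 (by simpa only [← h])
    by_contra hc
    by_cases hjg : j ∈ Set.range g
    · obtain ⟨i, rfl⟩ := hjg
      exact hj ⟨e.symm ⟨i, by simpa [h] using hc⟩, by simp⟩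
    · exact hc (h0 j hjg)
  · rintro ⟨I, _, e, ha⟩
    have hr : ∀ i : I, ∃ x, g x = e i := fun i => by
      by_contra hc
      exact (e i).2 (h0 _ hc)
    choose φ hφ using hr
    refine (isCountableSum_iff_csum (g := φ) (fun x y hxy => ?_) fun j hj => ?_).2
      (by simpa only [h, hφ])
    · exact e.injective (Subtype.ext (by rw [← hφ, ← hφ, hxy]))
    · rw [h]
      by_contra hc
      exact hj ⟨e.symm ⟨g j, hc⟩, hg (by rw [hφ]; simp)⟩

theorem isCountableSum_equiv_iff {ι κ : Type*} (e : ι ≃ κ) {α : ι → K} {β : κ → K}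
    (h : ∀ i, α i = β (e i)) {a : K} : IsCountableSum α a ↔ IsCountableSum β a :=
  isCountableSum_embedding_iff e.injective h fun j hj => (hj (e.surjective j)).elim

/-- A sum may be computed from the sums over the parts of a partition, here with parts indexed
by a type in any universe. -/
theorem IsCountableSum.parts {ι : Type} [Countable ι] {J : Type*} (f : ι → J) {α : ι → K}
    {r : J → K} {s : K} (hs : IsCountableSum α s)
    (hr : ∀ j, IsCountableSum (fun i : {i : ι // f i = j} => α i.1) (r j)) :
    IsCountableSum r s := by
  have : Small.{0} (Set.range f) := small_range f
  let e : Shrink.{0} (Set.range f) ≃ Set.range f := (equivShrink _).symm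
  have : Countable (Set.range f) := (Set.countable_range f).to_subtype
  have : Countable (Shrink.{0} (Set.range f)) := e.countable_iff.2 inferInstance
  have hg : Function.Injective fun j => (e j : J) := Subtype.val_injective.comp e.injective
  refine (isCountableSum_iff_csum hg fun j hj => ?_).2 ?_
  · have : IsEmpty {i : ι // f i = j} := ⟨fun i => hj ⟨e.symm ⟨j, i.1, i.2⟩, by simp⟩⟩
    exact (hr j).unique (isCountableSum_iff.2 (csum_of_isEmpty _))
  · refine csum_parts (fun i => e.symm ⟨f i, i, rfl⟩) α _ s (isCountableSum_iff.1 hs) fun j => ?_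
    have hj : ∀ i, e.symm ⟨f i, i, rfl⟩ = j ↔ f i = e j := fun i => by
      rw [Equiv.symm_apply_eq]
      exact Subtype.ext_iff
    exact csum_equiv (Equiv.subtypeEquivRight hj) (fun _ => rfl) (isCountableSum_iff.1 (hr (e j)))

theorem IsCountableSum.of_parts {ι J : Type} [Countable ι] [Countable J] (f : ι → J) {α : ι → K}
    {r : J → K} {s : K} (hs : IsCountableSum r s)
    (hr : ∀ j, IsCountableSum (fun i : {i : ι // f i = j} => α i.1) (r j)) :
    IsCountableSum α s :=
  isCountableSum_iff.2
    (csum_of_parts f α r s (fun j => isCountableSum_iff.1 (hr j)) (isCountableSum_iff.1 hs))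

theorem IsCountableSum.prod {ι κ : Type} [Countable ι] [Countable κ] {α : ι → K} {β : κ → K}
    {a b : K} (ha : IsCountableSum α a) (hb : IsCountableSum β b) :
    IsCountableSum (fun p : ι × κ => α p.1 * β p.2) (a * b) := by
  refine IsCountableSum.of_parts (J := ι) Prod.fst (r := fun i => α i * b)
    (isCountableSum_iff.2 (csum_mul_right _ _ _ (isCountableSum_iff.1 ha))) fun i => ?_
  let e : κ ≃ {p : ι × κ // p.1 = i} :=
    ⟨fun k => ⟨(i, k), rfl⟩, fun p => p.1.2, fun _ => rfl, by rintro ⟨⟨_, k⟩, rfl⟩; rfl⟩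
  exact (isCountableSum_equiv_iff e (α := fun k => α i * β k) fun k => rfl).1
    (isCountableSum_iff.2 (csum_mul_left _ _ _ (isCountableSum_iff.1 hb)))

theorem IsCountableSum.sumElim {ι κ : Type} [Countable ι] [Countable κ] {α : ι ⊕ κ → K}
    {a b : K} (ha : IsCountableSum (fun i => α (.inl i)) a)
    (hb : IsCountableSum (fun i => α (.inr i)) b) : IsCountableSum α (a + b) := by
  refine IsCountableSum.of_parts (J := Bool) (Sum.elim (fun _ => true) fun _ => false)
    (r := fun c => cond c a b) (isCountableSum_iff.2 ?_) fun c => ?_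
  · simpa using csum_fintype fun c => cond c a b
  · cases c
    · let g : κ → {x : ι ⊕ κ // Sum.elim (fun _ => true) (fun _ => false) x = false} :=
        fun k => ⟨.inr k, rfl⟩
      refine (isCountableSum_embedding_iff (g := g) (fun x y h => ?_) (fun k => rfl) ?_).1 hb
      · exact Sum.inr_injective (congrArg Subtype.val h)
      · rintro ⟨_ | k, h⟩ hj
        · simp at h
        · exact (hj ⟨_, rfl⟩).elim
    · let g : ι → {x : ι ⊕ κ // Sum.elim (fun _ => true) (fun _ => false) x = true} :=
        fun k => ⟨.inl k, rfl⟩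
      refine (isCountableSum_embedding_iff (g := g) (fun x y h => ?_) (fun k => rfl) ?_).1 ha
      · exact Sum.inl_injective (congrArg Subtype.val h)
      · rintro ⟨_ | k, h⟩ hj
        · exact (hj ⟨_, rfl⟩).elim
        · simp at h

/-- Nonempty lists are pairs of a head and a tail. -/
def consLengthEquiv (ι : Type) (n : ℕ) :
    ι × {l : List ι // l.length = n} ≃ {l : List ι // l.length = n + 1} where
  toFun p := ⟨p.1 :: p.2.1, by simp [p.2.2]⟩
  invFun l := (l.1.head (List.ne_nil_of_length_eq_add_one l.2), ⟨l.1.tail, by simp [l.2]⟩)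
  left_inv _ := rfl
  right_inv l := Subtype.ext (List.cons_head_tail _)

theorem IsCountableSum.list_length {ι : Type} [Countable ι] {α : ι → K} {a : K}
    (ha : IsCountableSum α a) (n : ℕ) :
    IsCountableSum (fun l : {l : List ι // l.length = n} => (l.1.map α).prod) (a ^ n) := by
  induction n with
  | zero =>
    have : Unique {l : List ι // l.length = 0} :=
      ⟨⟨⟨[], rfl⟩⟩, fun l => Subtype.ext (List.eq_nil_of_length_eq_zero l.2)⟩
    refine isCountableSum_iff.2 ?_
    have h1 := csum_of_unique fun l : {l : List ι // l.length = 0} => (l.1.map α).prod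
    rwa [List.eq_nil_of_length_eq_zero (default : {l : List ι // l.length = 0}).2, List.map_nil,
      List.prod_nil, ← pow_zero a] at h1
  | succ n ih =>
    rw [pow_succ']
    exact (isCountableSum_equiv_iff (consLengthEquiv ι n)
      fun p => List.prod_cons.symm).1 (ha.prod ih)

/-- The sum over all lists is the geometric sum of the sum over the letters. -/
theorem IsCountableSum.exists_list {ι : Type} [Countable ι] {α : ι → K} {a : K}
    (ha : IsCountableSum α a) :
    ∃ b, IsCountableSum (fun l : List ι => (l.map α).prod) b :=
  ⟨_, IsCountableSum.of_parts List.length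
    (isCountableSum_iff.2 (Part.get_mem (csum_geometric a))) ha.list_length⟩

end Sums

/-! ### Series of families of labelled weights -/

section Series

variable {K M : Type*} [Semiring K] [RationallyAdditive K]

/-- A family `v` of pairs (label, weight) sums up to the series `s`: for every `m`, the sum of
the weights of the members of the family labelled by `m` exists and is equal to `s m`. -/
def HasSeries {ι : Type*} (v : ι → M × K) (s : M → K) : Prop :=
  ∀ m, IsCountableSum (fun i : {i : ι // (v i).1 = m} => (v i.1).2) (s m)

theorem HasSeries.unique {ι : Type*} {v : ι → M × K} {s t : M → K} (hs : HasSeries v s)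
    (ht : HasSeries v t) : s = t :=
  funext fun m => (hs m).unique (ht m)

theorem hasSeries_embedding_iff {ι κ : Type*} {g : ι → κ} (hg : Function.Injective g)
    {v : ι → M × K} {w : κ → M × K} (h : ∀ i, v i = w (g i))
    (h0 : ∀ j ∉ Set.range g, (w j).2 = 0) {s : M → K} : HasSeries v s ↔ HasSeries w s := by
  refine forall_congr' fun m => isCountableSum_embedding_iff (κ := {j : κ // (w j).1 = m})
    (g := fun i : {i : ι // (v i).1 = m} => ⟨g i.1, by rw [← h, i.2]⟩) (fun x y hxy => ?_)
    (fun i => congrArg Prod.snd (h i.1)) ?_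
  · exact Subtype.ext (hg (congrArg Subtype.val hxy))
  · rintro ⟨j, hj⟩ hjr
    refine h0 j fun ⟨i, hi⟩ => hjr ⟨⟨i, by rw [h, hi, hj]⟩, Subtype.ext hi⟩

theorem hasSeries_equiv_iff {ι κ : Type*} (e : ι ≃ κ) {v : ι → M × K} {w : κ → M × K}
    (h : ∀ i, v i = w (e i)) {s : M → K} : HasSeries v s ↔ HasSeries w s :=
  hasSeries_embedding_iff e.injective h fun j hj => (hj (e.surjective j)).elim

theorem HasSeries.sumElim {ι κ : Type} [Countable ι] [Countable κ] {a : ι → M × K}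
    {b : κ → M × K} {s t : M → K} (ha : HasSeries a s) (hb : HasSeries b t) :
    HasSeries (Sum.elim a b) (s + t) := fun m => by
  refine (isCountableSum_equiv_iff (Equiv.subtypeSum (p := fun i => (Sum.elim a b i).1 = m)).symm
    (α := Sum.elim (fun i => (a i.1).2) fun j => (b j.1).2) ?_).1 ?_
  · rintro (i | j) <;> rfl
  · exact IsCountableSum.sumElim (ha m) (hb m)

/-- If the family of products of two families has a series, then this is the Cauchy product of
their series; in particular the sums in the Cauchy product exist. -/
theorem HasSeries.isCountableSum_mul [Monoid M] {ι κ : Type} [Countable ι] [Countable κ]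
    {a : ι → M × K} {b : κ → M × K} {s t r : M → K} (ha : HasSeries a s) (hb : HasSeries b t)
    (hr : HasSeries (fun p : ι × κ => a p.1 * b p.2) r) (m : M) :
    IsCountableSum (fun p : {p : M × M // p.1 * p.2 = m} => s p.1.1 * t p.1.2) (r m) := by
  refine (hr m).parts (fun x => ⟨((a x.1.1).1, (b x.1.2).1), x.2⟩) ?_
  rintro ⟨⟨m₁, m₂⟩, hm⟩
  refine (isCountableSum_embedding_iff
    (g := fun p : {i // (a i).1 = m₁} × {j // (b j).1 = m₂} =>
      ⟨⟨(p.1.1, p.2.1), by rw [Prod.fst_mul, p.1.2, p.2.2, ← hm]⟩,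
        Subtype.ext (Prod.ext p.1.2 p.2.2)⟩) ?_ (fun p => rfl) ?_).1 ((ha m₁).prod (hb m₂))
  · rintro ⟨⟨i, hi⟩, ⟨j, hj⟩⟩ ⟨⟨i', hi'⟩, ⟨j', hj'⟩⟩ h
    simp only [Subtype.mk.injEq, Prod.mk.injEq] at h
    obtain ⟨rfl, rfl⟩ := h
    rfl
  · rintro ⟨⟨⟨i, j⟩, hij⟩, h⟩ hn
    simp only [Subtype.mk.injEq, Prod.mk.injEq] at h
    exact (hn ⟨(⟨i, h.1⟩, ⟨j, h.2⟩), rfl⟩).elim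

/-- If the family of the products of all lists over a family has a series, then this is the sum of
the series of the lists of length `n`. -/
theorem HasSeries.isCountableSum_star [Monoid M] {ι : Type} [Countable ι] {a : ι → M × K}
    {p : ℕ → M → K} {r : M → K}
    (hp : ∀ n, HasSeries (fun l : {l : List ι // l.length = n} => (l.1.map a).prod) (p n))
    (hr : HasSeries (fun l : List ι => (l.map a).prod) r) (m : M) :
    IsCountableSum (fun n => p n m) (r m) := by
  refine (hr m).parts (fun x => x.1.length) fun n => ?_
  let e : {l : {l : List ι // l.length = n} // (l.1.map a).prod.1 = m} ≃
      {l : {l : List ι // (l.map a).prod.1 = m} // l.1.length = n} :=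
    ⟨fun l => ⟨⟨l.1.1, l.2⟩, l.1.2⟩, fun l => ⟨⟨l.1.1, l.2⟩, l.1.2⟩, fun _ => rfl, fun _ => rfl⟩
  exact (isCountableSum_equiv_iff e fun _ => rfl).1 (hp n m)

end Series

/-! ### Derivation trees of expressions -/

namespace WExpr

/-- The ways to derive a monomial from an expression: the semantics of an expression is the sum
of the monomials over all derivations. Atoms are represented by numbers, and the atom `0`, which
represents the weight `0`, has no derivation. -/
def Parse : WExpr ℕ ℕ → Type
  | weight k => PLift (k ≠ 0)
  | label _ => Unit
  | add U V => Parse U ⊕ Parse V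
  | mul U V => Parse U × Parse V
  | star U => List (Parse U)

instance countable_parse : ∀ W, Countable (Parse W)
  | weight k => inferInstanceAs (Countable (PLift (k ≠ 0)))
  | label _ => inferInstanceAs (Countable Unit)
  | add U V =>
    have := countable_parse U
    have := countable_parse V
    inferInstanceAs (Countable (Parse U ⊕ Parse V))
  | mul U V =>
    have := countable_parse U
    have := countable_parse V
    inferInstanceAs (Countable (Parse U × Parse V))
  | star U =>
    have := countable_parse U
    inferInstanceAs (Countable (List (Parse U)))

section

variable {K M : Type*} [Semiring K] [Monoid M] (κ : ℕ → K) (μ : ℕ → M)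

/-- The label and the weight of a derivation. -/
def val : (W : WExpr ℕ ℕ) → Parse W → M × K
  | weight k, _ => (1, κ k)
  | label m, _ => (μ m, 1)
  | add U V, x => Sum.elim (val U) (val V) x
  | mul U V, x => val U x.1 * val V x.2
  | star U, x => (x.map (val U)).prod

/-- The derivations of `Uⁿ` are the sequences of `n` derivations of `U`. -/
theorem exists_parse_pow_equiv (h1 : κ 1 = 1) (U : WExpr ℕ ℕ) (n : ℕ) :
    ∃ e : {l : List (Parse U) // l.length = n} ≃ Parse (U.pow n),
      ∀ l, (l.1.map (val κ μ U)).prod = val κ μ (U.pow n) (e l) := by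
  induction n with
  | zero =>
    have : Unique {l : List (Parse U) // l.length = 0} :=
      ⟨⟨⟨[], rfl⟩⟩, fun l => Subtype.ext (List.eq_nil_of_length_eq_zero l.2)⟩
    have : Unique (Parse (U.pow 0)) := ⟨⟨⟨one_ne_zero⟩⟩, fun _ => rfl⟩
    refine ⟨Equiv.ofUnique _ _, fun l => ?_⟩
    rw [List.eq_nil_of_length_eq_zero l.2]
    change 1 = ((1 : M), κ 1)
    rw [h1]
    rfl
  | succ n ih =>
    obtain ⟨e, he⟩ := ih
    let e' := (consLengthEquiv _ n).symm.trans ((Equiv.refl (Parse U)).prodCongr e)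
    have key : ∀ l, (l.1.map (val κ μ U)).prod =
        val κ μ U (e' l).1 * val κ μ (U.pow n) (e' l).2 := by
      refine (consLengthEquiv _ n).forall_congr_right.1 fun p => ?_
      simp only [e', Equiv.trans_apply, Equiv.symm_apply_apply]
      change ((p.1 :: p.2.1).map (val κ μ U)).prod = val κ μ U p.1 * val κ μ (U.pow n) (e p.2)
      rw [← he, List.map_cons, List.prod_cons]
    exact ⟨e', key⟩

variable [RationallyAdditive K]

/-- If labels are disregarded, the weights of the derivations of an expression always have a
sum. -/
theorem exists_isCountableSum_val (W : WExpr ℕ ℕ) :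
    ∃ a, IsCountableSum (fun x : Parse W => (val κ μ W x).2) a := by
  classical
  induction W with
  | weight k =>
    have : Fintype (Parse (weight k)) := inferInstanceAs (Fintype (PLift (k ≠ 0)))
    exact ⟨_, isCountableSum_iff.2 (RationallyAdditive.csum_fintype _)⟩
  | label m =>
    have : Fintype (Parse (label m)) := inferInstanceAs (Fintype Unit)
    exact ⟨_, isCountableSum_iff.2 (RationallyAdditive.csum_fintype _)⟩
  | add U V hU hV =>
    obtain ⟨a, ha⟩ := hU
    obtain ⟨b, hb⟩ := hV
    exact ⟨a + b, IsCountableSum.sumElim ha hb⟩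
  | mul U V hU hV =>
    obtain ⟨a, ha⟩ := hU
    obtain ⟨b, hb⟩ := hV
    exact ⟨a * b, IsCountableSum.prod ha hb⟩
  | star U hU =>
    obtain ⟨a, ha⟩ := hU
    obtain ⟨b, hb⟩ := ha.exists_list
    refine ⟨b, (isCountableSum_equiv_iff (Equiv.refl _) fun l => ?_).1 hb⟩
    have key : ∀ l : List (Parse U),
        (l.map fun x => (val κ μ U x).2).prod = (l.map (val κ μ U)).prod.2 := fun l => by
      induction l with
      | nil => rfl
      | cons x l ih => simp [ih]
    exact key l

theorem IsSemantics.unique {W : WExpr K M} {s t : M → K} (hs : W.IsSemantics s)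
    (ht : W.IsSemantics t) : s = t := by
  induction hs generalizing t with
  | weight k => cases ht; rfl
  | label m => cases ht; rfl
  | add _ _ hU hV =>
    cases ht with
    | add hU' hV' => rw [hU hU', hV hV']
  | mul _ _ hs hU hV =>
    cases ht with
    | mul hU' hV' ht =>
      cases hU hU'
      cases hV hV'
      exact funext fun m => (hs m).unique (ht m)
  | star _ hs hU =>
    cases ht with
    | star hU' ht =>
      cases funext fun n => hU n (hU' n)
      exact funext fun m => (hs m).unique (ht m)

theorem hasSeries_val_weight (h0 : κ 0 = 0) (k : ℕ) :
    HasSeries (val κ μ (weight k)) (Set.indicator {1} fun _ => κ k) := by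
  classical
  intro m
  by_cases hk : m = 1 ∧ k ≠ 0
  · obtain ⟨rfl, hk⟩ := hk
    have : Unique {x : Parse (weight k) // (val κ μ (weight k) x).1 = 1} :=
      ⟨⟨⟨⟨hk⟩, rfl⟩⟩, fun _ => rfl⟩
    refine isCountableSum_iff.2 ?_
    rw [Set.indicator_of_mem (Set.mem_singleton 1)]
    exact csum_of_unique fun x : {x : Parse (weight k) // (val κ μ (weight k) x).1 = 1} =>
      (val κ μ (weight k) x.1).2
  · have : IsEmpty {x : Parse (weight k) // (val κ μ (weight k) x).1 = m} :=
      ⟨fun x => hk ⟨x.2.symm, x.1.down⟩⟩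
    have hm : Set.indicator {1} (fun _ => κ k) m = 0 := by
      by_cases hm : m = 1
      · have hk' : k = 0 := by tauto
        simp [hk', h0, Set.indicator]
      · simp [hm]
    rw [hm]
    exact isCountableSum_iff.2 (csum_of_isEmpty _)

theorem hasSeries_val_label (k : ℕ) :
    HasSeries (val κ μ (label k)) (Set.indicator {μ k} fun _ => 1) := by
  intro m
  by_cases hm : m = μ k
  · subst hm
    have : Unique {x : Parse (label k) // (val κ μ (label k) x).1 = μ k} :=
      ⟨⟨⟨(), rfl⟩⟩, fun _ => rfl⟩
    refine isCountableSum_iff.2 ?_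
    rw [Set.indicator_of_mem (Set.mem_singleton (μ k))]
    exact csum_of_unique fun x : {x : Parse (label k) // (val κ μ (label k) x).1 = μ k} =>
      (val κ μ (label k) x.1).2
  · have : IsEmpty {x : Parse (label k) // (val κ μ (label k) x).1 = m} :=
      ⟨fun x => hm x.2.symm⟩
    rw [Set.indicator_of_notMem (by simpa using hm)]
    exact isCountableSum_iff.2 (csum_of_isEmpty _)

/-- When the derivations of all expressions have a series, this is the semantics of the
expression. -/
theorem isSemantics_map_iff (h0 : κ 0 = 0) (h1 : κ 1 = 1)
    (hex : ∀ W : WExpr ℕ ℕ, ∃ s, HasSeries (val κ μ W) s) (W : WExpr ℕ ℕ) (s : M → K) :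
    (W.map κ μ).IsSemantics s ↔ HasSeries (val κ μ W) s := by
  classical
  have key : ∀ (W : WExpr ℕ ℕ) (s : M → K), HasSeries (val κ μ W) s →
      (W.map κ μ).IsSemantics s := by
    intro W
    induction W with
    | weight k =>
      intro s hs
      cases hs.unique (hasSeries_val_weight κ μ h0 k)
      exact .weight (κ k)
    | label k =>
      intro s hs
      cases hs.unique (hasSeries_val_label κ μ k)
      exact .label (μ k)
    | add U V hU hV =>
      intro s hs
      obtain ⟨u, hu⟩ := hex U
      obtain ⟨v, hv⟩ := hex V
      cases hs.unique (hu.sumElim hv)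
      exact .add (hU u hu) (hV v hv)
    | mul U V hU hV =>
      intro s hs
      obtain ⟨u, hu⟩ := hex U
      obtain ⟨v, hv⟩ := hex V
      exact .mul (hU u hu) (hV v hv) (hu.isCountableSum_mul hv hs)
    | star U hU =>
      intro s hs
      choose p hp using fun n => hex (U.pow n)
      refine .star (p := p) (fun n => ?_) (HasSeries.isCountableSum_star (fun n => ?_) hs)
      · induction n with
        | zero =>
          rw [(hp 0).unique (hasSeries_val_weight κ μ h0 1), h1]
          exact .weight 1
        | succ n ih =>
          obtain ⟨u, hu⟩ := hex U
          exact .mul (hU u hu) ih (hu.isCountableSum_mul (hp n) (hp (n + 1)))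
      · obtain ⟨e, he⟩ := exists_parse_pow_equiv κ μ h1 U n
        exact (hasSeries_equiv_iff e he).2 (hp n)
  obtain ⟨t, ht⟩ := hex W
  refine ⟨fun h => ?_, key W s⟩
  rwa [h.unique (key W t ht)]

end

end WExpr

/-! ### Paths -/

/-- Entries `(p, m, k, q)` of the list of transitions of an automaton code: a transition from `p`
to `q` whose label and weight are represented by `m` and `k`. -/
abbrev Entry : Type := ℕ × ℕ × ℕ × ℕ

/-- `IsPath D S p w q`: the nonempty word `w` of entries in `D` is a path from `p` to `q` all of
whose intermediate states, that is, those strictly between the first and the last position, are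
in `S`. -/
inductive IsPath (D : Set Entry) (S : Set ℕ) : ℕ → List Entry → ℕ → Prop
  | single {p q : ℕ} {t : Entry} (ht : t ∈ D) (hp : t.1 = p) (hq : t.2.2.2 = q) :
      IsPath D S p [t] q
  | cons {p q : ℕ} {t : Entry} {w : List Entry} (ht : t ∈ D) (hp : t.1 = p) (hS : t.2.2.2 ∈ S)
      (hw : IsPath D S t.2.2.2 w q) : IsPath D S p (t :: w) q

namespace IsPath

variable {D D' : Set Entry} {S S' : Set ℕ} {p q r p' q' h : ℕ} {t : Entry} {w u x : List Entry}

theorem ne_nil (hw : IsPath D S p w q) : w ≠ [] := by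
  cases hw <;> simp

theorem mem (hw : IsPath D S p w q) : ∀ t ∈ w, t ∈ D := by
  induction hw with
  | single ht => simpa using ht
  | cons ht _ _ _ ih => exact List.forall_mem_cons.2 ⟨ht, ih⟩

theorem source_eq (hw : IsPath D S p w q) (hw' : IsPath D' S' p' w q') : p = p' := by
  cases hw <;> cases hw' <;> simp_all

theorem target_eq (hw : IsPath D S p w q) (hw' : IsPath D' S' p' w q') : q = q' := by
  induction hw generalizing p' with
  | single _ _ hq =>
    cases hw' with
    | single _ _ hq' => rw [← hq, ← hq']
    | cons _ _ _ hw => exact (hw.ne_nil rfl).elim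
  | cons _ _ _ hw ih =>
    cases hw' with
    | single => exact (hw.ne_nil rfl).elim
    | cons _ _ _ hw' => exact ih hw'

theorem mono (hw : IsPath D S p w q) (hD : ∀ t ∈ w, t ∈ D')
    (hS : ∀ t ∈ D, t.2.2.2 ∈ S → t.2.2.2 ∈ S') : IsPath D' S' p w q := by
  induction hw with
  | single _ hp hq => exact .single (hD _ (by simp)) hp hq
  | cons ht hp hs _ ih =>
    exact .cons (hD _ (by simp)) hp (hS _ ht hs) (ih fun t ht => hD t (by simp [ht]))

theorem append (hu : IsPath D S p u r) (hr : r ∈ S) (hx : IsPath D S r x q) :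
    IsPath D S p (u ++ x) q := by
  induction hu with
  | single ht hp hq => exact .cons ht hp (hq ▸ hr) (hq ▸ hx)
  | cons ht hp hS _ ih => exact .cons ht hp hS (ih hr hx)

theorem split (hw : IsPath D S p w q) (h : w = u ++ x) (hu : u ≠ []) (hx : x ≠ []) :
    ∃ r ∈ S, IsPath D S p u r ∧ IsPath D S r x q := by
  induction hw generalizing u with
  | single =>
    cases u with
    | nil => exact (hu rfl).elim
    | cons a u => simp_all
  | @cons _ _ t w ht hp hS hw ih =>
    cases u with
    | nil => exact (hu rfl).elim
    | cons a u =>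
      simp only [List.cons_append, List.cons.injEq] at h
      obtain ⟨rfl, rfl⟩ := h
      by_cases hu' : u = []
      · subst hu'
        exact ⟨_, hS, .single ht hp rfl, hw⟩
      · obtain ⟨r, hr, h1, h2⟩ := ih rfl hu'
        exact ⟨r, hr, .cons ht hp hS h1, h2⟩

/-- The paths to `h` that avoid `h` in between are a prefix code. -/
theorem append_left_inj (hh : h ∉ S) {u' x' : List Entry} (hu : IsPath D S p u h)
    (hu' : IsPath D S p u' h) (e : u ++ x = u' ++ x') : u = u' := by
  rcases List.append_eq_append_iff.1 e with ⟨a, rfl, -⟩ | ⟨a, rfl, -⟩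
  · by_cases ha : a = []
    · simp [ha]
    · obtain ⟨r, hr, h1, -⟩ := hu'.split rfl hu.ne_nil ha
      exact (hh (h1.target_eq hu ▸ hr)).elim
  · by_cases ha : a = []
    · simp [ha]
    · obtain ⟨r, hr, h1, -⟩ := hu.split rfl hu'.ne_nil ha
      exact (hh (h1.target_eq hu' ▸ hr)).elim

/-- The paths from `h` that avoid `h` in between are a suffix code. -/
theorem append_right_inj (hh : h ∉ S) {u' x' : List Entry} (hx : IsPath D S h x q)
    (hx' : IsPath D S h x' q) (e : u ++ x = u' ++ x') : x = x' := by
  rcases List.append_eq_append_iff.1 e with ⟨a, -, rfl⟩ | ⟨a, -, rfl⟩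
  · by_cases ha : a = []
    · simp [ha]
    · obtain ⟨r, hr, -, h1⟩ := hx.split rfl ha hx'.ne_nil
      exact (hh (h1.source_eq hx' ▸ hr)).elim
  · by_cases ha : a = []
    · simp [ha]
    · obtain ⟨r, hr, -, h1⟩ := hx'.split rfl ha hx.ne_nil
      exact (hh (h1.source_eq hx ▸ hr)).elim

theorem flatten_append {l : List (List Entry)} (hl : ∀ v ∈ l, IsPath D S h v h) (hh : h ∈ S)
    (hx : IsPath D S h x q) : IsPath D S h (l.flatten ++ x) q := by
  induction l with
  | nil => simpa
  | cons v l ih =>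
    rw [List.flatten_cons, List.append_assoc]
    exact (hl v (by simp)).append hh (ih fun v hv => hl v (by simp [hv]))

end IsPath

/-- The recursion of McNaughton and Yamada: a path that may visit `h` is decomposed at its visits
to `h`. -/
theorem isPath_insert_iff {D : Set Entry} {S : Set ℕ} {h p q : ℕ} {w : List Entry} :
    IsPath D (insert h S) p w q ↔ IsPath D S p w q ∨
      ∃ (u : List Entry) (l : List (List Entry)) (x : List Entry), IsPath D S p u h ∧
        (∀ v ∈ l, IsPath D S h v h) ∧ IsPath D S h x q ∧ u ++ l.flatten ++ x = w := by
  constructor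
  · intro hw
    induction hw with
    | single ht hp hq => exact .inl (.single ht hp hq)
    | @cons p q t w ht hp hS hw ih =>
      rcases hS with hS | hS
      · rw [hS] at ih
        rcases ih with ih | ⟨u, l, x, hu, hl, hx, rfl⟩
        · exact .inr ⟨[t], [], w, .single ht hp hS, by simp, ih, by simp⟩
        · exact .inr ⟨[t], u :: l, x, .single ht hp hS, by simpa using ⟨hu, hl⟩, hx, by simp⟩
      · rcases ih with ih | ⟨u, l, x, hu, hl, hx, rfl⟩
        · exact .inl (.cons ht hp hS ih)
        · exact .inr ⟨t :: u, l, x, .cons ht hp hS hu, hl, hx, by simp⟩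
  · have hmono : ∀ {p w q}, IsPath D S p w q → IsPath D (insert h S) p w q := fun hw =>
      hw.mono hw.mem fun t _ ht => Set.mem_insert_of_mem h ht
    rintro (hw | ⟨u, l, x, hu, hl, hx, rfl⟩)
    · exact hmono hw
    · rw [List.append_assoc]
      exact (hmono hu).append (Set.mem_insert h S)
        (IsPath.flatten_append (fun v hv => hmono (hl v hv)) (Set.mem_insert h S) (hmono hx))

/-- If intermediate states do not allow to switch between two sets of entries, a path stays in
one of them. -/
theorem isPath_union_iff {D₁ D₂ : Set Entry} {S : Set ℕ} {p q : ℕ} {w : List Entry}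
    (h₁ : ∀ t₁ ∈ D₁, ∀ t₂ ∈ D₂, t₁.2.2.2 ∈ S → t₁.2.2.2 ≠ t₂.1)
    (h₂ : ∀ t₂ ∈ D₂, ∀ t₁ ∈ D₁, t₂.2.2.2 ∈ S → t₂.2.2.2 ≠ t₁.1) :
    IsPath (D₁ ∪ D₂) S p w q ↔ IsPath D₁ S p w q ∨ IsPath D₂ S p w q := by
  constructor
  · intro hw
    induction hw with
    | single ht hp hq => exact ht.imp (fun ht => .single ht hp hq) fun ht => .single ht hp hq
    | @cons p q t w ht hp hS hw ih =>
      have hsrc : ∀ {D : Set Entry}, IsPath D S t.2.2.2 w q → ∃ t' ∈ D, t.2.2.2 = t'.1 := by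
        intro D hD
        cases hD with
        | single ht hp => exact ⟨_, ht, hp.symm⟩
        | cons ht hp => exact ⟨_, ht, hp.symm⟩
      rcases ht with ht | ht <;> rcases ih with ih | ih
      · exact .inl (.cons ht hp hS ih)
      · obtain ⟨t', ht', h⟩ := hsrc ih
        exact (h₁ t ht t' ht' hS h).elim
      · obtain ⟨t', ht', h⟩ := hsrc ih
        exact (h₂ t ht t' ht' hS h).elim
      · exact .inr (.cons ht hp hS ih)
  · rintro (hw | hw)
    · exact hw.mono (fun t ht => .inl (hw.mem t ht)) fun _ _ h => h
    · exact hw.mono (fun t ht => .inr (hw.mem t ht)) fun _ _ h => h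

theorem IsPath.exists_source {D : Set Entry} {S : Set ℕ} {p q : ℕ} {w : List Entry}
    (hw : IsPath D S p w q) : ∃ t ∈ D, t.1 = p := by
  cases hw with
  | single ht hp => exact ⟨_, ht, hp⟩
  | cons ht hp => exact ⟨_, ht, hp⟩

theorem IsPath.exists_target {D : Set Entry} {S : Set ℕ} {p q : ℕ} {w : List Entry}
    (hw : IsPath D S p w q) : ∃ t ∈ D, t.2.2.2 = q := by
  induction hw with
  | single ht _ hq => exact ⟨_, ht, hq⟩
  | cons _ _ _ _ ih => exact ih

/-! ### Expressions that represent sets of words -/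

namespace WExpr

/-- The sum of a list of expressions. -/
def listSum (l : List (WExpr ℕ ℕ)) : WExpr ℕ ℕ := l.foldr add (weight 0)

end WExpr

section Represents

variable {K M : Type*} [Semiring K] [Monoid M] (κ : ℕ → K) (μ : ℕ → M)

/-- The label and the weight of a word of entries. -/
def wordVal (w : List Entry) : M × K := (w.map fun t => (μ t.2.1, κ t.2.2.1)).prod

@[simp]
theorem wordVal_nil : wordVal κ μ [] = 1 := rfl

@[simp]
theorem wordVal_cons (t : Entry) (w : List Entry) :
    wordVal κ μ (t :: w) = (μ t.2.1, κ t.2.2.1) * wordVal κ μ w := by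
  simp [wordVal]

@[simp]
theorem wordVal_append (w w' : List Entry) :
    wordVal κ μ (w ++ w') = wordVal κ μ w * wordVal κ μ w' := by
  simp [wordVal]

open WExpr

/-- The expression `W` represents the set of words `L` unambiguously: the derivations of `W` are in
bijection with the words of `L`, with the same labels and weights. -/
def Represents (W : WExpr ℕ ℕ) (L : Set (List Entry)) : Prop :=
  ∃ e : Parse W → List Entry, Function.Injective e ∧ Set.range e = L ∧
    ∀ x, val κ μ W x = wordVal κ μ (e x)

variable {κ μ} {U V W : WExpr ℕ ℕ} {L L' : Set (List Entry)}

theorem Represents.congr (hW : Represents κ μ W L) (h : ∀ w, w ∈ L' ↔ w ∈ L) :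
    Represents κ μ W L' :=
  Set.ext h ▸ hW

theorem Represents.zero : Represents κ μ (weight 0) ∅ :=
  ⟨fun x => (x.down rfl).elim, fun x => (x.down rfl).elim,
    Set.eq_empty_of_forall_notMem fun _ ⟨x, _⟩ => x.down rfl, fun x => (x.down rfl).elim⟩

theorem Represents.add (hU : Represents κ μ U L) (hV : Represents κ μ V L') (h : Disjoint L L') :
    Represents κ μ (add U V) (L ∪ L') := by
  obtain ⟨e, he, rfl, hv⟩ := hU
  obtain ⟨e', he', rfl, hv'⟩ := hV
  refine ⟨Sum.elim e e', he.sumElim he' fun a b hab => ?_, Set.Sum.elim_range e e', ?_⟩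
  · exact Set.disjoint_left.1 h ⟨a, rfl⟩ ⟨b, hab.symm⟩
  · rintro (x | x)
    · exact hv x
    · exact hv' x

theorem Represents.mul (hU : Represents κ μ U L) (hV : Represents κ μ V L')
    (h : ∀ u ∈ L, ∀ v ∈ L', ∀ u' ∈ L, ∀ v' ∈ L', u ++ v = u' ++ v' → u = u' ∧ v = v') :
    Represents κ μ (mul U V) (Set.image2 (· ++ ·) L L') := by
  obtain ⟨e, he, rfl, hv⟩ := hU
  obtain ⟨e', he', rfl, hv'⟩ := hV
  refine ⟨fun x : Parse U × Parse V => e x.1 ++ e' x.2, ?_, ?_, fun x => ?_⟩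
  · intro x y hxy
    have := h _ ⟨x.1, rfl⟩ _ ⟨x.2, rfl⟩ _ ⟨y.1, rfl⟩ _ ⟨y.2, rfl⟩ hxy
    exact Prod.ext (he this.1) (he' this.2)
  · ext w
    constructor
    · rintro ⟨x, rfl⟩
      exact ⟨_, ⟨x.1, rfl⟩, _, ⟨x.2, rfl⟩, rfl⟩
    · rintro ⟨_, ⟨x, rfl⟩, _, ⟨y, rfl⟩, rfl⟩
      exact ⟨(x, y), rfl⟩
  · rw [wordVal_append, ← hv, ← hv']
    rfl

theorem Represents.star (hU : Represents κ μ U L)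
    (h0 : [] ∉ L) (h : ∀ u ∈ L, ∀ u' ∈ L, ∀ v v', u ++ v = u' ++ v' → u = u') :
    Represents κ μ (star U) {w | ∃ l : List (List Entry), (∀ v ∈ l, v ∈ L) ∧ l.flatten = w} := by
  obtain ⟨e, he, rfl, hv⟩ := hU
  refine ⟨fun l : List (Parse U) => (l.map e).flatten, ?_, ?_, ?_⟩
  · intro l
    induction l with
    | nil =>
      intro l' hl
      cases l' with
      | nil => rfl
      | cons y l' => exact (h0 ⟨y, (List.append_eq_nil_iff.1 hl.symm).1⟩).elim
    | cons x l ih =>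
      intro l' hl
      cases l' with
      | nil => exact (h0 ⟨x, (List.append_eq_nil_iff.1 hl).1⟩).elim
      | cons y l' =>
        simp only [List.map_cons, List.flatten_cons] at hl
        have hxy := h _ ⟨x, rfl⟩ _ ⟨y, rfl⟩ _ _ hl
        rw [hxy] at hl
        rw [he hxy, ih (List.append_cancel_left hl)]
  · ext w
    constructor
    · rintro ⟨l, rfl⟩
      refine ⟨l.map e, fun v hv => ?_, rfl⟩
      obtain ⟨x, -, rfl⟩ := List.mem_map.1 hv
      exact ⟨x, rfl⟩
    · rintro ⟨l, hl, rfl⟩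
      obtain ⟨l', rfl⟩ : l ∈ Set.range (List.map e) := by
        rw [Set.range_list_map]
        exact hl
      exact ⟨l', rfl⟩
  · have key : ∀ l : List (Parse U),
        (l.map (val κ μ U)).prod = wordVal κ μ (l.map e).flatten := fun l => by
      induction l with
      | nil => rfl
      | cons x l ih => simp [ih, hv]
    exact key

theorem Represents.entry (t : Entry) (ht : t.2.2.1 ≠ 0) :
    Represents κ μ (WExpr.mul (label t.2.1) (weight t.2.2.1)) {[t]} := by
  have : Unique (Parse (WExpr.mul (label t.2.1) (weight t.2.2.1))) :=
    ⟨⟨((), ⟨ht⟩)⟩, fun _ => rfl⟩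
  refine ⟨fun _ => [t], Function.injective_of_subsingleton _, Set.range_const, fun x => ?_⟩
  rw [wordVal_cons, wordVal_nil, mul_one]
  exact Prod.ext (mul_one _) (one_mul _)

theorem Represents.listSum {ι : Type*} {l : List ι} {E : ι → WExpr ℕ ℕ}
    {L : ι → Set (List Entry)} (hE : ∀ i ∈ l, Represents κ μ (E i) (L i)) (hl : l.Nodup)
    (hL : ∀ i ∈ l, ∀ j ∈ l, i ≠ j → Disjoint (L i) (L j)) :
    Represents κ μ (.listSum (l.map E)) {w | ∃ i ∈ l, w ∈ L i} := by
  induction l with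
  | nil => simpa [WExpr.listSum] using Represents.zero
  | cons i l ih =>
    have h1 := ih (fun j hj => hE j (by simp [hj])) hl.of_cons
      fun j hj k hk => hL j (by simp [hj]) k (by simp [hk])
    have h2 := (hE i (by simp)).add h1 (Set.disjoint_left.2 fun w hw ⟨j, hj, hwj⟩ =>
      Set.disjoint_left.1 (hL i (by simp) j (by simp [hj])
        fun hij => (List.nodup_cons.1 hl).1 (hij ▸ hj)) hw hwj)
    exact h2.congr fun w => by simp

/-- One step of state elimination. -/
theorem Represents.insert {D : Set Entry} {S : Set ℕ} {h p q : ℕ} (hh : h ∉ S)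
    {E₀ E₁ E₂ E₃ : WExpr ℕ ℕ} (h₀ : Represents κ μ E₀ {w | IsPath D S p w q})
    (h₁ : Represents κ μ E₁ {w | IsPath D S p w h})
    (h₂ : Represents κ μ E₂ {w | IsPath D S h w h})
    (h₃ : Represents κ μ E₃ {w | IsPath D S h w q}) :
    Represents κ μ (.add E₀ (.mul (.mul E₁ (.star E₂)) E₃))
      {w | IsPath D (insert h S) p w q} := by
  have hs := h₂.star (fun h => h.ne_nil rfl) fun u hu u' hu' v v' e => hu.append_left_inj hh hu' e
  have h4 := h₁.mul hs fun u hu v _ u' hu' v' _ e => by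
    obtain rfl := hu.append_left_inj hh hu' e
    exact ⟨rfl, List.append_cancel_left e⟩
  have h5 := h4.mul h₃ fun u _ x hx u' _ x' hx' e => by
    obtain rfl := hx.append_right_inj hh hx' e
    exact ⟨List.append_cancel_right e, rfl⟩
  have h6 := h₀.add h5 ?_
  · refine h6.congr fun w => ?_
    rw [Set.mem_ofPred_eq, isPath_insert_iff]
    refine or_congr Iff.rfl ⟨?_, ?_⟩
    · rintro ⟨u, l, x, hu, hl, hx, rfl⟩
      exact ⟨_, ⟨u, hu, _, ⟨l, hl, rfl⟩, rfl⟩, x, hx, rfl⟩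
    · rintro ⟨_, ⟨u, hu, _, ⟨l, hl, rfl⟩, rfl⟩, x, hx, rfl⟩
      exact ⟨u, l, x, hu, hl, hx, rfl⟩
  · rw [Set.disjoint_left]
    rintro _ hw ⟨_, ⟨u, hu, y, -, rfl⟩, x, hx, rfl⟩
    obtain ⟨r, hr, h1, -⟩ := IsPath.split hw (List.append_assoc u y x) hu.ne_nil
      (by simp [hx.ne_nil])
    exact hh (h1.target_eq hu ▸ hr)

end Represents

/-! ### From automata to expressions -/

namespace AutomatonCode

open WExpr

/-- The set of the entries of a code that mention existing states only. -/
def entries (c : AutomatonCode) : Set Entry :=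
  {t | t ∈ c.2.2.1 ∧ t.1 < c.1 ∧ t.2.2.2 < c.1}

/-- The words of entries of a code that form accepting runs. -/
def acceptedWords (c : AutomatonCode) : Set (List Entry) :=
  {w | ∃ p ∈ c.2.1, ∃ q ∈ c.2.2.2, IsPath c.entries Set.univ p w q}

/-- The entries of a code that mention existing states only, and whose weight is not represented
by `0`, without repetitions. -/
def nonzeroEntries (c : AutomatonCode) : List Entry :=
  (c.2.2.1.filter fun t => t.1 < c.1 ∧ t.2.2.2 < c.1 ∧ t.2.2.1 ≠ 0).dedup

/-- The expression that represents the paths of length one from `x.1` to `x.2`. -/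
def entrySum (D : List Entry) (x : ℕ × ℕ) : WExpr ℕ ℕ :=
  listSum ((D.filter fun t => t.1 = x.1 ∧ t.2.2.2 = x.2).map fun t =>
    mul (label t.2.1) (weight t.2.2.1))

/-- The expression for the paths from `x.1` to `x.2` with intermediate states at most `h`, from a
table `T` of expressions for paths with intermediate states below `h`. -/
def eliminate (T : List (WExpr ℕ ℕ)) (h : ℕ) (x : ℕ × ℕ) : WExpr ℕ ℕ :=
  add (T.getD (Nat.pair x.1 x.2) (weight 0))
    (mul (mul (T.getD (Nat.pair x.1 h) (weight 0)) (star (T.getD (Nat.pair h h) (weight 0))))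
      (T.getD (Nat.pair h x.2) (weight 0)))

/-- The table of McNaughton and Yamada: for states `p` and `q` below `n`, the entry at position
`Nat.pair p q` is an expression for the paths from `p` to `q` all of whose intermediate states
are below `h`. -/
def pathTable (n : ℕ) (D : List Entry) (h : ℕ) : List (WExpr ℕ ℕ) :=
  h.rec ((List.range (n * n)).map fun i => entrySum D i.unpair)
    fun h T => (List.range (n * n)).map fun i => eliminate T h i.unpair

/-- The pairs of an initial and a final state, without repetitions. -/
def endpoints (c : AutomatonCode) : List (ℕ × ℕ) :=
  ((c.2.1.flatMap fun p => c.2.2.2.map fun q => (p, q)).filter fun x =>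
    x.1 < c.1 ∧ x.2 < c.1).dedup

/-- An expression with the same semantics as the automaton. -/
def toExpr (c : AutomatonCode) : WExpr ℕ ℕ :=
  listSum (c.endpoints.map fun x =>
    (pathTable c.1 c.nonzeroEntries c.1).getD (Nat.pair x.1 x.2) (weight 0))

section Correctness

variable {K M : Type*} [Semiring K] [Monoid M] {κ : ℕ → K} {μ : ℕ → M}

theorem getD_map_range {E : ℕ × ℕ → WExpr ℕ ℕ} {n p q : ℕ} (hp : p < n) (hq : q < n) :
    ((List.range (n * n)).map fun i => E i.unpair).getD (Nat.pair p q) (weight 0) = E (p, q) := by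
  have h : Nat.pair p q < n * n := by
    have h1 := Nat.pair_lt_max_add_one_sq p q
    have h2 : max p q + 1 ≤ n := max_lt hp hq
    nlinarith [Nat.pow_le_pow_left h2 2]
  simp [List.getD_eq_getElem?_getD, h]

theorem represents_entrySum {D : List Entry} (hD : D.Nodup) (h0 : ∀ t ∈ D, t.2.2.1 ≠ 0)
    (p q : ℕ) : Represents κ μ (entrySum D (p, q)) {w | IsPath {t | t ∈ D} ∅ p w q} := by
  have h := Represents.listSum (κ := κ) (μ := μ) (L := fun t => {[t]})
    (l := D.filter fun t => t.1 = p ∧ t.2.2.2 = q)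
    (fun t ht => Represents.entry t (h0 t (List.mem_of_mem_filter ht))) (hD.filter _)
    fun t _ t' _ hne => by simpa using hne
  refine h.congr fun w => ?_
  simp only [Set.mem_ofPred_eq, Set.mem_singleton_iff, List.mem_filter, decide_eq_true_eq]
  constructor
  · rintro (⟨ht, hp, hq⟩ | ⟨_, _, h, _⟩)
    · exact ⟨_, ⟨ht, hp, hq⟩, rfl⟩
    · exact h.elim
  · rintro ⟨t, ⟨ht, hp, hq⟩, rfl⟩
    exact .single ht hp hq

theorem represents_pathTable {D : List Entry} (hD : D.Nodup) (h0 : ∀ t ∈ D, t.2.2.1 ≠ 0) {n : ℕ}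
    (h : ℕ) (hn : h ≤ n) {p q : ℕ} (hp : p < n) (hq : q < n) :
    Represents κ μ ((pathTable n D h).getD (Nat.pair p q) (weight 0))
      {w | IsPath {t | t ∈ D} {i | i < h} p w q} := by
  induction h generalizing p q with
  | zero =>
    have h1 := represents_entrySum (κ := κ) (μ := μ) hD h0 p q
    have h2 : {i : ℕ | i < 0} = ∅ := by ext; simp
    rw [h2]
    exact (getD_map_range (E := entrySum D) hp hq).symm ▸ h1
  | succ h ih =>
    have h2 : {i : ℕ | i < h + 1} = insert h {i | i < h} := by ext; simp; omega
    have ih' := fun {p q} => @ih (by omega) p q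
    rw [h2]
    exact (getD_map_range (E := eliminate (pathTable n D h) h) hp hq).symm ▸
      Represents.insert (by simp) (ih' hp hq) (ih' hp hn) (ih' hn hn) (ih' hn hq)

/-- The expression of an automaton represents its accepting runs through entries with nonzero
weight. -/
theorem represents_toExpr (c : AutomatonCode) :
    Represents κ μ c.toExpr {w | w ∈ c.acceptedWords ∧ ∀ t ∈ w, t.2.2.1 ≠ 0} := by
  have hmem : ∀ t, t ∈ c.nonzeroEntries ↔ t ∈ c.entries ∧ t.2.2.1 ≠ 0 := fun t => by
    simp [nonzeroEntries, entries]
    tauto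
  have h := Represents.listSum (κ := κ) (μ := μ) (l := c.endpoints)
    (E := fun x => (pathTable c.1 c.nonzeroEntries c.1).getD (Nat.pair x.1 x.2) (weight 0))
    (L := fun x => {w | IsPath {t | t ∈ c.nonzeroEntries} {i | i < c.1} x.1 w x.2})
    (fun x hx => represents_pathTable (List.nodup_dedup _) (fun t ht => ((hmem t).1 ht).2) c.1
      le_rfl (by simp [endpoints] at hx; omega) (by simp [endpoints] at hx; omega))
    (List.nodup_dedup _) fun x _ y _ hxy => Set.disjoint_left.2 fun w hw hw' =>
      hxy (Prod.ext (IsPath.source_eq hw hw') (IsPath.target_eq hw hw'))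
  refine h.congr fun w => ?_
  constructor
  · rintro ⟨⟨p, hp, q, hq, hw⟩, hw0⟩
    refine ⟨(p, q), ?_, hw.mono (fun t ht => (hmem t).2 ⟨hw.mem t ht, hw0 t ht⟩)
      fun t ht _ => ht.2.2⟩
    obtain ⟨t, ht, rfl⟩ := hw.exists_source
    obtain ⟨t', ht', rfl⟩ := hw.exists_target
    simpa [endpoints, ht.2.1, ht'.2.2] using ⟨hp, hq⟩
  · rintro ⟨x, hx, hw⟩
    simp only [endpoints, List.mem_dedup, List.mem_filter, List.mem_flatMap, List.mem_map] at hx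
    obtain ⟨⟨p, hp, q, hq, rfl⟩, -⟩ := hx
    exact ⟨⟨p, hp, q, hq, IsPath.mono hw (fun t ht => ((hmem t).1 (hw.mem t ht)).1)
      fun _ _ _ => trivial⟩, fun t ht => ((hmem t).1 (hw.mem t ht)).2⟩

theorem _root_.Represents.hasSeries_iff [RationallyAdditive K] {W : WExpr ℕ ℕ}
    {L : Set (List Entry)} (h : Represents κ μ W L) {s : M → K} :
    HasSeries (val κ μ W) s ↔ HasSeries (fun w : L => wordVal κ μ w.1) s := by
  obtain ⟨e, he, rfl, hv⟩ := h
  exact hasSeries_equiv_iff (Equiv.ofInjective e he) hv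

/-- Runs through an entry of weight zero do not contribute to the semantics. -/
theorem hasSeries_toExpr_iff [RationallyAdditive K] (h0 : κ 0 = 0) (c : AutomatonCode)
    {s : M → K} : HasSeries (val κ μ c.toExpr) s ↔
      HasSeries (fun w : c.acceptedWords => wordVal κ μ w.1) s := by
  rw [(represents_toExpr c).hasSeries_iff]
  have hg : Function.Injective fun w : {w | w ∈ c.acceptedWords ∧ ∀ t ∈ w, t.2.2.1 ≠ 0} =>
      (⟨w.1, w.2.1⟩ : c.acceptedWords) := fun x y h =>
    Subtype.ext (congrArg (fun z : c.acceptedWords => z.1) h)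
  refine hasSeries_embedding_iff hg (w := fun w : c.acceptedWords => wordVal κ μ w.1)
    (fun _ => rfl) ?_
  rintro ⟨w, hw⟩ hn
  have : ∃ t ∈ w, t.2.2.1 = 0 := by
    by_contra! hc
    exact hn ⟨⟨w, hw, hc⟩, rfl⟩
  obtain ⟨t, ht, ht0⟩ := this
  change (MonoidHom.snd M K) (wordVal κ μ w) = 0
  rw [wordVal, map_list_prod, List.map_map]
  exact List.prod_eq_zero (List.mem_map.2 ⟨t, ht, by simp [ht0, h0]⟩)

end Correctness

end AutomatonCode

/-! ### Computability of the expression of an automaton -/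

namespace Primrec

open WExpr

variable {α β : Type*} [Primcodable α] [Primcodable β]

theorem wexpr_iff {f : α → WExpr ℕ ℕ} : Primrec f ↔ Primrec fun a => (f a).toNat :=
  Primrec.encode_iff.symm

theorem wexpr_weight {f : α → ℕ} (hf : Primrec f) :
    Primrec fun a => (weight (f a) : WExpr ℕ ℕ) :=
  wexpr_iff.2 (nat_mul.comp (const 5) hf)

theorem wexpr_label {f : α → ℕ} (hf : Primrec f) :
    Primrec fun a => (label (f a) : WExpr ℕ ℕ) :=
  wexpr_iff.2 (nat_add.comp (nat_mul.comp (const 5) hf) (const 1))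

theorem wexpr_add {f g : α → WExpr ℕ ℕ} (hf : Primrec f) (hg : Primrec g) :
    Primrec fun a => add (f a) (g a) :=
  wexpr_iff.2 (nat_add.comp (nat_mul.comp (const 5)
    (Primrec₂.natPair.comp (wexpr_iff.1 hf) (wexpr_iff.1 hg))) (const 2))

theorem wexpr_mul {f g : α → WExpr ℕ ℕ} (hf : Primrec f) (hg : Primrec g) :
    Primrec fun a => mul (f a) (g a) :=
  wexpr_iff.2 (nat_add.comp (nat_mul.comp (const 5)
    (Primrec₂.natPair.comp (wexpr_iff.1 hf) (wexpr_iff.1 hg))) (const 3))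

theorem wexpr_star {f : α → WExpr ℕ ℕ} (hf : Primrec f) : Primrec fun a => star (f a) :=
  wexpr_iff.2 (nat_add.comp (nat_mul.comp (const 5) (wexpr_iff.1 hf)) (const 4))

theorem wexpr_listSum {f : α → List (WExpr ℕ ℕ)} (hf : Primrec f) :
    Primrec fun a => listSum (f a) :=
  list_foldr hf (const _) (wexpr_add (fst.comp snd) (snd.comp snd)).to₂

theorem list_dedup [DecidableEq β] : Primrec (List.dedup : List β → List β) := by
  have h : Primrec fun l : List β => l.foldr (fun b s => if b ∈ s then s else b :: s) [] := by
    have hi : PrimrecPred fun x : List β × β × List β => x.2.2.idxOf x.2.1 < x.2.2.length :=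
      nat_lt.comp (list_idxOf.comp (fst.comp snd) (snd.comp snd)) (list_length.comp (snd.comp snd))
    have hp : PrimrecPred fun x : List β × β × List β => x.2.1 ∈ x.2.2 :=
      hi.of_eq fun x => List.idxOf_lt_length_iff
    exact list_foldr .id (const [])
      (Primrec.ite hp (snd.comp snd) (list_cons.comp (fst.comp snd) (snd.comp snd))).to₂
  refine h.of_eq fun l => ?_
  induction l with
  | nil => rfl
  | cons b l ih =>
    rw [List.foldr_cons, ih]
    by_cases hb : b ∈ l
    · simp [hb, List.dedup_cons_of_mem hb]
    · simp [hb, List.dedup_cons_of_notMem hb]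

end Primrec

namespace AutomatonCode

open Primrec WExpr

theorem primrec_entrySum : Primrec₂ entrySum := by
  have hR : PrimrecRel fun (t : Entry) (x : ℕ × ℕ) => t.1 = x.1 ∧ t.2.2.2 = x.2 :=
    (Primrec.eq.comp (fst.comp fst) (fst.comp snd)).and
      (Primrec.eq.comp (snd.comp (snd.comp (snd.comp fst))) (snd.comp snd))
  exact wexpr_listSum (list_map hR.listFilter (wexpr_mul
    (wexpr_label (fst.comp (snd.comp snd)))
    (wexpr_weight (fst.comp (snd.comp (snd.comp snd))))))

theorem primrec_eliminate : Primrec fun y : List (WExpr ℕ ℕ) × ℕ × ℕ × ℕ =>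
    eliminate y.1 y.2.1 y.2.2 := by
  have hg : ∀ {p q : List (WExpr ℕ ℕ) × ℕ × ℕ × ℕ → ℕ}, Primrec p → Primrec q →
      Primrec fun y : List (WExpr ℕ ℕ) × ℕ × ℕ × ℕ => y.1.getD (Nat.pair (p y) (q y)) (weight 0) :=
    fun hp hq => (list_getD _).comp fst (Primrec₂.natPair.comp hp hq)
  have h1 : Primrec fun y : List (WExpr ℕ ℕ) × ℕ × ℕ × ℕ => y.2.1 := fst.comp snd
  have h2 : Primrec fun y : List (WExpr ℕ ℕ) × ℕ × ℕ × ℕ => y.2.2.1 := fst.comp (snd.comp snd)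
  have h3 : Primrec fun y : List (WExpr ℕ ℕ) × ℕ × ℕ × ℕ => y.2.2.2 := snd.comp (snd.comp snd)
  exact wexpr_add (hg h2 h3) (wexpr_mul (wexpr_mul (hg h2 h1) (wexpr_star (hg h1 h1))) (hg h1 h3))

theorem primrec_pathTable :
    Primrec fun y : ℕ × List Entry => pathTable y.1 y.2 y.1 := by
  have hr : Primrec fun y : ℕ × List Entry => List.range (y.1 * y.1) :=
    list_range.comp (nat_mul.comp fst fst)
  exact nat_rec' fst
    (list_map hr (primrec_entrySum.comp (snd.comp fst) (unpair.comp snd)).to₂)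
    (list_map (hr.comp fst) (primrec_eliminate.comp
      (pair (snd.comp (snd.comp fst)) (pair (fst.comp (snd.comp fst)) (unpair.comp snd)))).to₂).to₂

theorem primrec_nonzeroEntries : Primrec nonzeroEntries := by
  have hR : PrimrecRel fun (t : Entry) (n : ℕ) => t.1 < n ∧ t.2.2.2 < n ∧ t.2.2.1 ≠ 0 :=
    (nat_lt.comp (fst.comp fst) snd).and ((nat_lt.comp (snd.comp (snd.comp (snd.comp fst))) snd).and
      (Primrec.eq.comp (fst.comp (snd.comp (snd.comp fst))) (const 0)).not)
  exact list_dedup.comp (hR.listFilter.comp (fst.comp (snd.comp snd)) fst)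

theorem primrec_endpoints : Primrec endpoints := by
  have hR : PrimrecRel fun (x : ℕ × ℕ) (n : ℕ) => x.1 < n ∧ x.2 < n :=
    (nat_lt.comp (fst.comp fst) snd).and (nat_lt.comp (snd.comp fst) snd)
  refine list_dedup.comp (hR.listFilter.comp (list_flatMap (fst.comp snd) ?_) fst)
  exact list_map (snd.comp (snd.comp (snd.comp fst))) (pair (snd.comp fst) snd)

theorem primrec_toExpr : Primrec toExpr :=
  wexpr_listSum (list_map primrec_endpoints ((list_getD _).comp
    (primrec_pathTable.comp (pair (fst.comp fst) (primrec_nonzeroEntries.comp fst)))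
    (Primrec₂.natPair.comp (fst.comp snd) (snd.comp snd))))

end AutomatonCode

/-! ### Sums over regular languages -/

section Regular

variable {K : Type*} [Semiring K] [RationallyAdditive K]

/-- The run of an automaton on a word, as a word of entries of its code. The codes of states and
letters are given by `i` and `j`; letters are encoded as nonzero weights. -/
def DFA.tag {A σ : Type*} (B : DFA A σ) (i : σ → ℕ) (j : A → ℕ) : σ → List A → List Entry
  | _, [] => []
  | x, a :: w => (i x, 0, j a + 1, i (B.step x a)) :: B.tag i j (B.step x a) w

theorem DFA.map_tag {A σ : Type*} (B : DFA A σ) (i : σ → ℕ) (j : A → ℕ) (x : σ) (w : List A) :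
    (B.tag i j x w).map (fun t => t.2.2.1) = w.map fun a => j a + 1 := by
  induction w generalizing x with
  | nil => rfl
  | cons a w ih => simp [tag, ih]

theorem DFA.isPath_iff_exists_tag {A σ : Type*} (B : DFA A σ) {i : σ → ℕ}
    (hi : Function.Injective i) {j : A → ℕ} {D : Set Entry}
    (hD : ∀ t, t ∈ D ↔ ∃ x a, (i x, 0, j a + 1, i (B.step x a)) = t) {x : σ} {q : ℕ}
    {v : List Entry} : IsPath D Set.univ (i x) v q ↔
      ∃ w, w ≠ [] ∧ B.tag i j x w = v ∧ i (B.evalFrom x w) = q := by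
  constructor
  · intro h
    induction v generalizing x with
    | nil => exact (h.ne_nil rfl).elim
    | cons t v ih =>
      cases h with
      | single ht hp hq =>
        obtain ⟨y, a, rfl⟩ := (hD _).1 ht
        obtain rfl := hi hp
        exact ⟨[a], by simp, rfl, hq⟩
      | cons ht hp _ hw =>
        obtain ⟨y, a, rfl⟩ := (hD _).1 ht
        obtain rfl := hi hp
        obtain ⟨w, -, rfl, rfl⟩ := ih hw
        exact ⟨a :: w, by simp, rfl, rfl⟩
  · rintro ⟨w, hw, rfl, rfl⟩
    induction w generalizing x with
    | nil => exact (hw rfl).elim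
    | cons a w ih =>
      have ha : (i x, 0, j a + 1, i (B.step x a)) ∈ D := (hD _).2 ⟨x, a, rfl⟩
      by_cases hw' : w = []
      · subst hw'
        exact .single ha rfl rfl
      · exact .cons ha rfl trivial (ih hw')

/-- The sum over the nonempty words of a regular language exists. A deterministic automaton is
turned into an expression without ambiguity, and sums over derivations exist if labels are
disregarded. -/
theorem Language.IsRegular.exists_isCountableSum {A : Type} [Finite A] {L : Language A}
    (hL : L.IsRegular) (f : A → K) :
    ∃ a, IsCountableSum (fun w : {w : List A // w ∈ L ∧ w ≠ []} => (w.1.map f).prod) a := by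
  classical
  obtain ⟨σ, _, B, rfl⟩ := hL
  have := Fintype.ofFinite A
  let i : σ → ℕ := fun x => Fintype.equivFin σ x
  have hi : Function.Injective i := Fin.val_injective.comp (Fintype.equivFin σ).injective
  obtain ⟨j, hj⟩ := exists_injective_nat A
  let κ : ℕ → K := fun k => k.casesOn 0 (Function.extend j f 0)
  let μ : ℕ → Unit := fun _ => ()
  have hκ : ∀ a, κ (j a + 1) = f a := fun a => hj.extend_apply f 0 a
  let c : AutomatonCode := (Fintype.card σ, [i B.start],
    (Finset.univ : Finset (σ × A)).toList.map fun x => (i x.1, 0, j x.2 + 1, i (B.step x.1 x.2)),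
    (Finset.univ.filter (· ∈ B.accept)).toList.map i)
  have hD : ∀ t, t ∈ c.entries ↔ ∃ x a, (i x, 0, j a + 1, i (B.step x a)) = t := fun t => by
    simp only [AutomatonCode.entries, c, Set.mem_ofPred_eq, List.mem_map, Finset.mem_toList,
      Finset.mem_univ, true_and, Prod.exists]
    constructor
    · exact fun h => h.1
    · rintro ⟨x, a, rfl⟩
      exact ⟨⟨x, a, rfl⟩, Fin.is_lt _, Fin.is_lt _⟩
  have hacc : ∀ v, v ∈ c.acceptedWords ↔
      ∃ w, (w ∈ B.accepts ∧ w ≠ []) ∧ B.tag i j B.start w = v := fun v => by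
    simp only [AutomatonCode.acceptedWords, Set.mem_ofPred_eq, c, List.mem_singleton,
      exists_eq_left, List.mem_map, Finset.mem_toList, Finset.mem_filter, Finset.mem_univ,
      true_and]
    constructor
    · rintro ⟨_, ⟨y, hy, rfl⟩, h⟩
      obtain ⟨w, hw, rfl, hq⟩ := (B.isPath_iff_exists_tag hi hD).1 h
      obtain rfl : B.eval w = y := hi hq
      exact ⟨w, ⟨hy, hw⟩, rfl⟩
    · rintro ⟨w, ⟨hw, hne⟩, rfl⟩
      exact ⟨_, ⟨_, hw, rfl⟩, (B.isPath_iff_exists_tag hi hD).2 ⟨w, hne, rfl, rfl⟩⟩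
  obtain ⟨a, ha⟩ := WExpr.exists_isCountableSum_val κ μ c.toExpr
  have hs : HasSeries (WExpr.val κ μ c.toExpr) fun _ => a := fun m =>
    (isCountableSum_equiv_iff (Equiv.subtypeUnivEquiv fun x => rfl) fun _ => rfl).2 ha
  rw [AutomatonCode.hasSeries_toExpr_iff rfl] at hs
  refine ⟨a, (isCountableSum_embedding_iff
    (g := fun w : {w : List A // w ∈ B.accepts ∧ w ≠ []} =>
      (⟨⟨B.tag i j B.start w.1, (hacc _).2 ⟨w.1, w.2, rfl⟩⟩, rfl⟩ :
        {w : c.acceptedWords // (wordVal κ μ w.1).1 = ()}))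
    (β := fun w => (wordVal κ μ w.1.1).2) ?_ ?_ ?_).2 (hs ())⟩
  · intro w w' h
    have h1 : B.tag i j B.start w.1 = B.tag i j B.start w'.1 := by
      simpa only [Subtype.mk.injEq] using h
    have h2 := congrArg (List.map fun t => t.2.2.1) h1
    rw [DFA.map_tag, DFA.map_tag] at h2
    exact Subtype.ext (List.map_injective_iff.2
      (fun a b hab => hj (Nat.succ_injective hab)) h2)
  · rintro ⟨w, hw⟩
    change _ = (MonoidHom.snd Unit K) (wordVal κ μ (B.tag i j B.start w))
    have h1 : (MonoidHom.snd Unit K) ∘ (fun t : Entry => (μ t.2.1, κ t.2.2.1)) =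
      κ ∘ fun t => t.2.2.1 := rfl
    rw [wordVal, map_list_prod, List.map_map, h1, ← List.map_map, DFA.map_tag, List.map_map]
    simp only [Function.comp_def, hκ]
  · rintro ⟨⟨v, hv⟩, hv'⟩ hn
    obtain ⟨w, hw, rfl⟩ := (hacc v).1 hv
    exact (hn ⟨⟨w, hw⟩, rfl⟩).elim

end Regular

/-! ### Automata over pre-rational monoids are valid -/

namespace AutomatonCode

/-- The accepting runs of an automaton form a regular language: by the Myhill–Nerode theorem, as
the left quotient by a nonempty prefix of a run only depends on the last letter. -/
theorem isRegular_acceptedWords (c : AutomatonCode) :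
    Language.IsRegular
      ({w : List c.entries | w.map Subtype.val ∈ c.acceptedWords} : Language c.entries) := by
  have hfin : Finite c.entries :=
    ((List.finite_toSet c.2.2.1).subset fun t ht => ht.1).to_subtype
  let L : Language c.entries := {w : List c.entries | w.map Subtype.val ∈ c.acceptedWords}
  let g : Option (Option c.entries) → Language c.entries := fun o =>
    o.elim (∅ : Set (List c.entries)) fun o => o.elim L fun b =>
      {y : List c.entries | ∃ q ∈ c.2.2.2, (y = [] ∧ b.1.2.2.2 = q) ∨
        IsPath c.entries Set.univ b.1.2.2.2 (y.map Subtype.val) q}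
  refine .of_finite_range_leftQuotient ((Set.finite_range g).subset ?_)
  rintro _ ⟨x, rfl⟩
  rcases List.eq_nil_or_concat' x with rfl | ⟨x, b, rfl⟩
  · exact ⟨some none, rfl⟩
  by_cases hx : ∃ p ∈ c.2.1, IsPath c.entries Set.univ p ((x ++ [b]).map Subtype.val) b.1.2.2.2
  · obtain ⟨p, hp, hx⟩ := hx
    refine ⟨some (some b), Set.ext fun y => ?_⟩
    change (∃ q ∈ c.2.2.2, _) ↔ ((x ++ [b]) ++ y).map Subtype.val ∈ c.acceptedWords
    rw [List.map_append]
    constructor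
    · rintro ⟨q, hq, ⟨rfl, rfl⟩ | h⟩
      · exact ⟨p, hp, _, hq, by simpa using hx⟩
      · exact ⟨p, hp, q, hq, hx.append trivial h⟩
    · rintro ⟨p', _, q, hq, h⟩
      by_cases hy : y = []
      · subst hy
        exact ⟨q, hq, .inl ⟨rfl, hx.target_eq (by simpa using h)⟩⟩
      · obtain ⟨r, -, h1, h2⟩ := h.split rfl (by simp) (by simpa using hy)
        exact ⟨q, hq, .inr (hx.target_eq h1 ▸ h2)⟩
  · refine ⟨none, Set.ext fun y => ?_⟩
    change False ↔ ((x ++ [b]) ++ y).map Subtype.val ∈ c.acceptedWords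
    rw [List.map_append, false_iff]
    rintro ⟨p, hp, q, hq, h⟩
    have hlast : ∀ {r}, IsPath c.entries Set.univ p ((x ++ [b]).map Subtype.val) r →
        r = b.1.2.2.2 := fun {r} hr => by
      rw [List.map_append] at hr
      by_cases hx' : x = []
      · subst hx'
        exact hr.target_eq (IsPath.single (S := Set.univ) b.2 rfl rfl)
      · obtain ⟨r', -, -, h2⟩ := hr.split rfl (by simpa using hx') (by simp)
        exact h2.target_eq (IsPath.single (S := Set.univ) b.2 rfl rfl)
    by_cases hy : y = []
    · subst hy
      rw [List.map_nil, List.append_nil] at h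
      exact hx ⟨p, hp, hlast h ▸ h⟩
    · obtain ⟨r, -, h1, -⟩ := h.split rfl (by simp) (by simpa using hy)
      exact hx ⟨p, hp, hlast h1 ▸ h1⟩

/-- Over a pre-rational monoid, the accepting runs with a given label form a regular language, so
that every automaton is valid. -/
theorem exists_hasSeries {K M : Type*} [Semiring K] [RationallyAdditive K] [Monoid M]
    (hM : PreRational M) (κ : ℕ → K) (μ : ℕ → M) (c : AutomatonCode) :
    ∃ s, HasSeries (fun w : c.acceptedWords => wordVal κ μ w.1) s := by
  have hfin : Finite c.entries :=
    ((List.finite_toSet c.2.2.1).subset fun t ht => ht.1).to_subtype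
  have hval : ∀ w : List c.entries, wordVal κ μ (w.map Subtype.val) =
      (FreeMonoid.lift (fun t : c.entries => μ t.1.2.1) (FreeMonoid.ofList w),
        (w.map fun t => κ t.1.2.2.1).prod) := fun w => by
    induction w with
    | nil => rfl
    | cons t w ih => simp [ih, FreeMonoid.ofList_cons]
  have hreg := fun m => c.isRegular_acceptedWords.inf
    (hM c.entries (FreeMonoid.lift fun t => μ t.1.2.1) m)
  choose s hs using fun m => (hreg m).exists_isCountableSum fun t : c.entries => κ t.1.2.2.1
  refine ⟨s, fun m => (isCountableSum_embedding_iff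
    (β := fun w : {w : c.acceptedWords // (wordVal κ μ w.1).1 = m} => (wordVal κ μ w.1.1).2)
    (g := fun w => ⟨⟨w.1.map Subtype.val, w.2.1.1⟩, by rw [hval]; exact w.2.1.2⟩) ?_ ?_ ?_).1
    (hs m)⟩
  · intro w w' h
    simp only [Subtype.mk.injEq] at h
    exact Subtype.ext (List.map_injective_iff.2 Subtype.val_injective h)
  · intro w
    simp only [hval]
  · rintro ⟨⟨w, hw⟩, hm⟩ hn
    obtain ⟨p, hp, q, hq, h⟩ := id hw
    obtain ⟨w, rfl⟩ : w ∈ Set.range (List.map (Subtype.val : c.entries → Entry)) := by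
      rw [Set.range_list_map]
      simpa using h.mem
    refine (hn ⟨⟨w, ⟨hw, ?_⟩, ?_⟩, rfl⟩).elim
    · rw [hval] at hm
      exact hm
    · rintro rfl
      exact h.ne_nil rfl

end AutomatonCode

/-! ### From expressions to automata -/

namespace WExpr

/-- The number of interior states of the automaton of an expression. -/
def size : WExpr ℕ ℕ → ℕ
  | weight _ => 1
  | label _ => 1
  | add U V => U.size + V.size
  | mul U V => U.size + V.size + 1
  | star U => U.size + 1

/-- The transitions of the automaton of an expression, with initial state `p`, final state `q` and
interior states numbered from `o` on. There are no transitions from `p` to `q`, so that sums need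
no additional states, and there is at most one transition between two states. -/
def compile : WExpr ℕ ℕ → ℕ → ℕ → ℕ → List Entry
  | weight k, p, q, o => if k = 0 then [] else [(p, 0, k, o), (o, 0, 1, q)]
  | label m, p, q, o => [(p, m, 1, o), (o, 0, 1, q)]
  | add U V, p, q, o => U.compile p q o ++ V.compile p q (o + U.size)
  | mul U V, p, q, o => U.compile p o (o + 1) ++ V.compile o q (o + 1 + U.size)
  | star U, p, q, o => [(p, 0, 1, o), (o, 0, 1, q)] ++ U.compile o o (o + 1)

/-- The code of an automaton with the same semantics as the expression. -/
def toAut (W : WExpr ℕ ℕ) : AutomatonCode := (2 + W.size, [0], W.compile 0 1 2, [1])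

/-- A transition of the automaton of an expression begins at `p` or in the interior, ends at `q` or
in the interior, and has at least one of its ends in the interior. -/
theorem states_of_mem_compile {W : WExpr ℕ ℕ} {p q o : ℕ} {t : Entry} (ht : t ∈ W.compile p q o) :
    (t.1 = p ∨ o ≤ t.1 ∧ t.1 < o + W.size) ∧ (t.2.2.2 = q ∨ o ≤ t.2.2.2 ∧ t.2.2.2 < o + W.size) ∧
      (o ≤ t.1 ∨ o ≤ t.2.2.2) := by
  induction W generalizing p q o with
  | weight k =>
    by_cases hk : k = 0
    · simp [compile, hk] at ht
    · simp only [compile, hk, if_false, List.mem_cons, List.not_mem_nil, or_false] at ht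
      rcases ht with rfl | rfl <;> simp [size]
  | label m =>
    simp only [compile, List.mem_cons, List.not_mem_nil, or_false] at ht
    rcases ht with rfl | rfl <;> simp [size]
  | add U V hU hV =>
    simp only [size]
    rcases List.mem_append.1 ht with ht | ht
    · have := hU ht
      omega
    · have := hV ht
      omega
  | mul U V hU hV =>
    simp only [size]
    rcases List.mem_append.1 ht with ht | ht
    · have := hU ht
      omega
    · have := hV ht
      omega
  | star U hU =>
    simp only [size]
    rcases List.mem_append.1 ht with ht | ht
    · simp only [List.mem_cons, List.not_mem_nil, or_false] at ht
      rcases ht with rfl | rfl <;> simp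
    · have := hU ht
      omega

theorem eq_of_mem_compile {W : WExpr ℕ ℕ} {p q o : ℕ} (hp : p < o) (hq : q < o) {t t' : Entry}
    (ht : t ∈ W.compile p q o) (ht' : t' ∈ W.compile p q o) (h₁ : t.1 = t'.1)
    (h₂ : t.2.2.2 = t'.2.2.2) : t = t' := by
  induction W generalizing p q o with
  | weight k =>
    by_cases hk : k = 0
    · simp [compile, hk] at ht
    · simp only [compile, hk, if_false, List.mem_cons, List.not_mem_nil, or_false] at ht ht'
      rcases ht with rfl | rfl <;> rcases ht' with rfl | rfl <;> simp at h₁ h₂ ⊢ <;> omega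
  | label m =>
    simp only [compile, List.mem_cons, List.not_mem_nil, or_false] at ht ht'
    rcases ht with rfl | rfl <;> rcases ht' with rfl | rfl <;> simp at h₁ h₂ ⊢ <;> omega
  | add U V hU hV =>
    rcases List.mem_append.1 ht with ht | ht <;> rcases List.mem_append.1 ht' with ht' | ht'
    · exact hU hp hq ht ht'
    · have := states_of_mem_compile ht
      have := states_of_mem_compile ht'
      omega
    · have := states_of_mem_compile ht
      have := states_of_mem_compile ht'
      omega
    · exact hV (by omega) (by omega) ht ht'
  | mul U V hU hV =>
    rcases List.mem_append.1 ht with ht | ht <;> rcases List.mem_append.1 ht' with ht' | ht'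
    · exact hU (by omega) (by omega) ht ht'
    · have := states_of_mem_compile ht
      have := states_of_mem_compile ht'
      omega
    · have := states_of_mem_compile ht
      have := states_of_mem_compile ht'
      omega
    · exact hV (by omega) (by omega) ht ht'
  | star U hU =>
    rcases List.mem_append.1 ht with ht | ht <;> rcases List.mem_append.1 ht' with ht' | ht'
    · simp only [List.mem_cons, List.not_mem_nil, or_false] at ht ht'
      rcases ht with rfl | rfl <;> rcases ht' with rfl | rfl <;> simp at h₁ h₂ ⊢ <;> omega
    · have := states_of_mem_compile ht'
      simp only [List.mem_cons, List.not_mem_nil, or_false] at ht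
      rcases ht with rfl | rfl <;> simp at h₁ h₂ <;> omega
    · have := states_of_mem_compile ht
      simp only [List.mem_cons, List.not_mem_nil, or_false] at ht'
      rcases ht' with rfl | rfl <;> simp at h₁ h₂ <;> omega
    · exact hU (by omega) (by omega) ht ht'

theorem faithful_toAut {K M : Type*} (κ : ℕ → K) (μ : ℕ → M) (W : WExpr ℕ ℕ) :
    W.toAut.Faithful κ μ := by
  intro t ht t' ht' h
  simp only [Prod.mk.injEq] at h
  exact eq_of_mem_compile (by omega) (by omega) ht ht' h.1 h.2.2.2

end WExpr

section

open WExpr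

variable {K M : Type*} [Semiring K] [Monoid M] {κ : ℕ → K} {μ : ℕ → M}

theorem Represents.of_bijective {W W' : WExpr ℕ ℕ} {L : Set (List Entry)}
    (hW : Represents κ μ W L) {g : Parse W' → Parse W} (hg : Function.Bijective g)
    (h : ∀ x, val κ μ W' x = val κ μ W (g x)) : Represents κ μ W' L := by
  obtain ⟨e, he, rfl, hv⟩ := hW
  exact ⟨e ∘ g, he.comp hg.1, hg.2.range_comp e, fun x => by rw [h, hv]; rfl⟩

theorem Represents.singleton {W : WExpr ℕ ℕ} [Unique (Parse W)] {w : List Entry}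
    (h : val κ μ W default = wordVal κ μ w) : Represents κ μ W {w} :=
  ⟨fun _ => w, Function.injective_of_subsingleton _, Set.range_const, fun x => by
    rw [Unique.eq_default x, h]⟩

theorem isPath_congr {D : Set Entry} {S S' : Set ℕ} {p q : ℕ} {w : List Entry}
    (h : ∀ t ∈ D, t.2.2.2 ∈ S ↔ t.2.2.2 ∈ S') : IsPath D S p w q ↔ IsPath D S' p w q :=
  ⟨fun hw => hw.mono hw.mem fun t ht => (h t ht).1, fun hw => hw.mono hw.mem fun t ht => (h t ht).2⟩

theorem isPath_iff_of_forall_notMem {D : Set Entry} {S : Set ℕ} {p q : ℕ} {w : List Entry}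
    (h : ∀ t ∈ D, t.2.2.2 ∉ S) : IsPath D S p w q ↔ ∃ t ∈ D, t.1 = p ∧ t.2.2.2 = q ∧ w = [t] := by
  constructor
  · rintro (⟨ht, hp, hq⟩ | ⟨ht, -, hS, -⟩)
    · exact ⟨_, ht, hp, hq, rfl⟩
    · exact (h _ ht hS).elim
  · rintro ⟨t, ht, hp, hq, rfl⟩
    exact .single ht hp hq

theorem isPath_pair_iff {p q o a b a' b' : ℕ} {w : List Entry} (hp : p < o) (hq : q < o) :
    IsPath {t | t ∈ [(p, a, b, o), (o, a', b', q)]} {i | o ≤ i} p w q ↔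
      w = [(p, a, b, o), (o, a', b', q)] := by
  have hmem : ∀ {t : Entry}, t ∈ {t | t ∈ [(p, a, b, o), (o, a', b', q)]} →
      t = (p, a, b, o) ∨ t = (o, a', b', q) := fun ht => by simpa using ht
  constructor
  · rintro (⟨ht, h1, h2⟩ | ⟨ht, h1, h2, hw⟩)
    · rcases hmem ht with rfl | rfl <;> simp at h1 h2 <;> omega
    · rcases hmem ht with rfl | rfl
      · rcases hw with ⟨ht, h1, h2⟩ | ⟨ht, h1, h2, hw⟩
        · rcases hmem ht with rfl | rfl
          · simp at h1 h2
            omega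
          · rfl
        · rcases hmem ht with rfl | rfl <;> simp at h1 h2 <;> omega
      · simp at h1 h2
        omega
  · rintro rfl
    exact .cons (by simp) rfl (le_refl o) (.single (by simp) rfl rfl)

/-- The derivations of an expression are the paths through its automaton. Products and stars are
obtained by elimination of the state that joins the parts. -/
theorem represents_compile (h1 : κ 1 = 1) (hμ : μ 0 = 1) (W : WExpr ℕ ℕ) {p q o : ℕ} (hp : p < o)
    (hq : q < o) :
    Represents κ μ W {w | IsPath {t | t ∈ W.compile p q o} {i | o ≤ i} p w q} := by
  have hins : ∀ o : ℕ, {i | o ≤ i} = insert o {i | o + 1 ≤ i} := fun o => by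
    ext i
    simp only [Set.mem_ofPred_eq, Set.mem_insert_iff]
    omega
  have hnot : ∀ o : ℕ, o ∉ {i | o + 1 ≤ i} := fun o => by simp
  induction W generalizing p q o with
  | weight k =>
    by_cases hk : k = 0
    · subst hk
      refine Represents.zero.congr fun w => iff_of_false (fun hw => ?_) fun h => h
      obtain ⟨t, ht, -⟩ := hw.exists_source
      simp [compile] at ht
    · have : Unique (Parse (weight k)) := ⟨⟨⟨hk⟩⟩, fun _ => rfl⟩
      refine (Represents.singleton (w := [(p, 0, k, o), (o, 0, 1, q)]) ?_).congr fun w => ?_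
      · simp [val, h1, hμ]
      · rw [compile, if_neg hk]
        exact isPath_pair_iff hp hq
  | label m =>
    have : Unique (Parse (label m)) := inferInstanceAs (Unique Unit)
    refine (Represents.singleton (w := [(p, m, 1, o), (o, 0, 1, q)]) ?_).congr fun w => ?_
    · simp [val, h1, hμ]
    · exact isPath_pair_iff hp hq
  | add U V hU hV =>
    refine ((hU hp hq).add (hV (p := p) (q := q) (o := o + U.size) (by omega) (by omega))
      ?_).congr fun w => ?_
    · refine Set.disjoint_left.2 fun w hw hw' => ?_
      have hw : IsPath _ _ _ _ _ := hw
      have hw' : IsPath _ _ _ _ _ := hw'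
      -- no entry belongs to both parts
      obtain ⟨t, ht⟩ := List.exists_mem_of_ne_nil w hw.ne_nil
      have := states_of_mem_compile (hw.mem t ht)
      have := states_of_mem_compile (hw'.mem t ht)
      omega
    · have hD : {t | t ∈ (add U V).compile p q o} =
          {t | t ∈ U.compile p q o} ∪ {t | t ∈ V.compile p q (o + U.size)} :=
        Set.ext fun t => List.mem_append
      rw [Set.mem_ofPred_eq, hD, isPath_union_iff]
      · refine or_congr Iff.rfl (isPath_congr fun t ht => ?_)
        have := states_of_mem_compile ht
        simp only [Set.mem_ofPred_eq]
        omega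
      all_goals
        intro t ht t' ht' hS
        have := states_of_mem_compile ht
        have := states_of_mem_compile ht'
        simp only [Set.mem_ofPred_eq] at hS
        omega
  | mul U V hU hV =>
    have hD : {t | t ∈ (mul U V).compile p q o} =
        {t | t ∈ U.compile p o (o + 1)} ∪ {t | t ∈ V.compile o q (o + 1 + U.size)} :=
      Set.ext fun t => List.mem_append
    have hunion : ∀ {p' w q'}, IsPath {t | t ∈ (mul U V).compile p q o} {i | o + 1 ≤ i} p' w q' ↔
        IsPath {t | t ∈ U.compile p o (o + 1)} {i | o + 1 ≤ i} p' w q' ∨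
          IsPath {t | t ∈ V.compile o q (o + 1 + U.size)} {i | o + 1 ≤ i} p' w q' := by
      intro p' w q'
      rw [hD, isPath_union_iff]
      all_goals
        intro t ht t' ht' hS
        have := states_of_mem_compile ht
        have := states_of_mem_compile ht'
        simp only [Set.mem_ofPred_eq] at hS
        omega
    have hUpath : ∀ {p' w q'}, IsPath {t | t ∈ U.compile p o (o + 1)} {i | o + 1 ≤ i} p' w q' →
        (p' = p ∨ o < p') ∧ o ≤ q' := fun hw => by
      obtain ⟨t, ht, rfl⟩ := hw.exists_source
      obtain ⟨t', ht', rfl⟩ := hw.exists_target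
      have := states_of_mem_compile ht
      have := states_of_mem_compile ht'
      omega
    have hVpath : ∀ {p' w q'}, IsPath {t | t ∈ V.compile o q (o + 1 + U.size)} {i | o + 1 ≤ i}
        p' w q' → o ≤ p' ∧ (q' = q ∨ o < q') := fun hw => by
      obtain ⟨t, ht, rfl⟩ := hw.exists_source
      obtain ⟨t', ht', rfl⟩ := hw.exists_target
      have := states_of_mem_compile ht
      have := states_of_mem_compile ht'
      omega
    rw [hins]
    have key := Represents.insert (κ := κ) (μ := μ) (hnot o)
      (D := {t | t ∈ (mul U V).compile p q o}) (p := p) (q := q)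
      (Represents.zero.congr fun w => iff_of_false (fun hw => ?_) fun h => h)
      ((hU (p := p) (q := o) (o := o + 1) (by omega) (by omega)).congr fun w => ?_)
      (Represents.zero.congr fun w => iff_of_false (fun hw => ?_) fun h => h)
      ((hV (p := o) (q := q) (o := o + 1 + U.size) (by omega) (by omega)).congr fun w => ?_)
    · have : IsEmpty (Parse (weight 0)) := ⟨fun x => x.down rfl⟩
      refine key.of_bijective (W' := mul U V)
        (g := fun x : Parse U × Parse V => .inr ((x.1, []), x.2)) ⟨fun x y h => ?_, fun x => ?_⟩
        fun x => ?_
      · have h' := Sum.inr_injective h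
        exact Prod.ext (congrArg (fun y => y.1.1) h') (congrArg (fun y => y.2) h')
      · rcases x with x | ⟨⟨u, _ | ⟨x, l⟩⟩, v⟩
        · exact (IsEmpty.false x).elim
        · exact ⟨(u, v), rfl⟩
        · exact (IsEmpty.false x).elim
      · change val κ μ U x.1 * val κ μ V x.2 = val κ μ U x.1 * 1 * val κ μ V x.2
        rw [mul_one]
    · rcases hunion.1 hw with hw | hw
      · have := hUpath hw
        omega
      · have := hVpath hw
        omega
    · refine hunion.trans (or_iff_left fun hw => ?_)
      have := hVpath hw
      omega
    · rcases hunion.1 hw with hw | hw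
      · have := hUpath hw
        omega
      · have := hVpath hw
        omega
    · refine hunion.trans ((or_iff_right fun hw => ?_).trans (isPath_congr fun t ht => ?_))
      · have := hUpath hw
        omega
      · have := states_of_mem_compile ht
        simp only [Set.mem_ofPred_eq]
        omega
  | star U hU =>
    have hD : {t | t ∈ (star U).compile p q o} =
        {t | t ∈ [(p, 0, 1, o), (o, 0, 1, q)]} ∪ {t | t ∈ U.compile o o (o + 1)} :=
      Set.ext fun t => List.mem_append
    have hpair : ∀ {t : Entry}, t ∈ {t | t ∈ [(p, 0, 1, o), (o, 0, 1, q)]} →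
        t = (p, 0, 1, o) ∨ t = (o, 0, 1, q) := fun ht => by simpa using ht
    have hunion : ∀ {p' w q'}, IsPath {t | t ∈ (star U).compile p q o} {i | o + 1 ≤ i} p' w q' ↔
        (∃ t ∈ {t | t ∈ [(p, 0, 1, o), (o, 0, 1, q)]}, t.1 = p' ∧ t.2.2.2 = q' ∧ w = [t]) ∨
          IsPath {t | t ∈ U.compile o o (o + 1)} {i | o + 1 ≤ i} p' w q' := by
      intro p' w q'
      have hnS : ∀ t ∈ {t | t ∈ [(p, 0, 1, o), (o, 0, 1, q)]}, t.2.2.2 ∉ {i | o + 1 ≤ i} := by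
        intro t ht
        rcases hpair ht with rfl | rfl
        · simp
        · simp only [Set.mem_ofPred_eq]
          omega
      rw [hD, isPath_union_iff fun t ht _ _ hS => (hnS t ht hS).elim,
        isPath_iff_of_forall_notMem hnS]
      intro t ht t' ht' hS
      have := states_of_mem_compile ht
      simp only [Set.mem_ofPred_eq] at hS
      rcases hpair ht' with rfl | rfl <;> simp <;> omega
    have hUpath : ∀ {p' w q'}, IsPath {t | t ∈ U.compile o o (o + 1)} {i | o + 1 ≤ i} p' w q' →
        o ≤ p' ∧ o ≤ q' := fun hw => by
      obtain ⟨t, ht, rfl⟩ := hw.exists_source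
      obtain ⟨t', ht', rfl⟩ := hw.exists_target
      have := states_of_mem_compile ht
      have := states_of_mem_compile ht'
      omega
    rw [hins]
    have key := Represents.insert (κ := κ) (μ := μ) (hnot o)
      (D := {t | t ∈ (star U).compile p q o}) (p := p) (q := q)
      (Represents.zero.congr fun w => iff_of_false (fun hw => ?_) fun h => h)
      ((Represents.entry (p, 0, 1, o) one_ne_zero).congr fun w => ?_)
      ((hU (p := o) (q := o) (o := o + 1) (by omega) (by omega)).congr fun w => ?_)
      ((Represents.entry (o, 0, 1, q) one_ne_zero).congr fun w => ?_)
    · have : IsEmpty (Parse (weight 0)) := ⟨fun x => x.down rfl⟩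
      refine key.of_bijective (W' := star U)
        (g := fun l : List (Parse U) => .inr ((((), ⟨one_ne_zero⟩), l), ((), ⟨one_ne_zero⟩)))
        ⟨fun x y h => ?_, fun x => ?_⟩ fun x => ?_
      · exact congrArg (fun y => y.1.2) (Sum.inr_injective h)
      · rcases x with x | ⟨⟨_, l⟩, _⟩
        · exact (IsEmpty.false x).elim
        · exact ⟨l, rfl⟩
      · change val κ μ (star U) x = (μ 0, 1) * (1, κ 1) * val κ μ (star U) x * ((μ 0, 1) * (1, κ 1))
        rw [h1, hμ]
        change _ = 1 * 1 * _ * (1 * 1)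
        simp
    · rcases hunion.1 hw with ⟨t, ht, h1, h2, -⟩ | hw
      · rcases hpair ht with rfl | rfl <;> simp at h1 h2 <;> omega
      · have := hUpath hw
        omega
    · refine hunion.trans ⟨?_, fun hw => .inl ⟨_, by simp, rfl, rfl, hw⟩⟩
      rintro (⟨t, ht, h1, h2, rfl⟩ | hw)
      · rcases hpair ht with rfl | rfl
        · rfl
        · simp at h1 h2
          omega
      · have := hUpath hw
        omega
    · refine hunion.trans (or_iff_right ?_)
      rintro ⟨t, ht, h1, h2, -⟩
      rcases hpair ht with rfl | rfl <;> simp at h1 h2 <;> omega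
    · refine hunion.trans ⟨?_, fun hw => .inl ⟨_, by simp, rfl, rfl, hw⟩⟩
      rintro (⟨t, ht, h1, h2, rfl⟩ | hw)
      · rcases hpair ht with rfl | rfl
        · simp at h1 h2
          omega
        · rfl
      · have := hUpath hw
        omega

theorem represents_acceptedWords_toAut (h1 : κ 1 = 1) (hμ : μ 0 = 1) (W : WExpr ℕ ℕ) :
    Represents κ μ W W.toAut.acceptedWords := by
  refine (represents_compile h1 hμ W (p := 0) (q := 1) (o := 2) (by omega) (by omega)).congr
    fun w => ?_
  have hmem : ∀ {t}, t ∈ W.toAut.entries ↔ t ∈ {t | t ∈ W.compile 0 1 2} := fun {t} => by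
    refine ⟨fun h => h.1, fun h => ⟨h, ?_⟩⟩
    have := states_of_mem_compile h
    simp only [toAut]
    omega
  constructor
  · rintro ⟨p, hp, q, hq, hw⟩
    obtain rfl : p = 0 := by simpa [toAut] using hp
    obtain rfl : q = 1 := by simpa [toAut] using hq
    -- no transition leaves the final state, so that it is not passed through
    have hpath : ∀ {p w q}, IsPath W.toAut.entries Set.univ p w q →
        IsPath {t | t ∈ W.compile 0 1 2} {i | 2 ≤ i} p w q := by
      intro p w q hw
      induction hw with
      | single ht hp hq => exact .single (hmem.1 ht) hp hq
      | cons ht hp _ hw ih =>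
        refine .cons (hmem.1 ht) hp ?_ ih
        obtain ⟨t', ht', h⟩ := hw.exists_source
        have := states_of_mem_compile ht.1
        have := states_of_mem_compile ht'.1
        simp only [Set.mem_ofPred_eq]
        omega
    exact hpath hw
  · exact fun hw => ⟨0, by simp [toAut], 1, by simp [toAut],
      IsPath.mono hw (fun t ht => hmem.2 (IsPath.mem hw t ht)) fun _ _ _ => trivial⟩

end

/-! ### Computability of the automaton of an expression -/

namespace WExpr

/-- The renaming of states that maps `0` to `p`, `1` to `q` and the states from `2` on to the
states from `o` on. -/
def renameState (x : ℕ × ℕ × ℕ) (i : ℕ) : ℕ :=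
  if i = 0 then x.1 else if i = 1 then x.2.1 else i - 2 + x.2.2

/-- The effect of `renameState` on entries. -/
def rename (x : ℕ × ℕ × ℕ) (t : Entry) : Entry :=
  (renameState x t.1, t.2.1, t.2.2.1, renameState x t.2.2.2)

theorem map_compile (f : ℕ → ℕ) (W : WExpr ℕ ℕ) (p q o : ℕ) (hf : ∀ i, f (o + i) = f o + i) :
    (W.compile p q o).map (fun t => (f t.1, t.2.1, t.2.2.1, f t.2.2.2)) =
      W.compile (f p) (f q) (f o) := by
  have shift : ∀ {o}, (∀ i, f (o + i) = f o + i) → ∀ j i, f (o + j + i) = f (o + j) + i :=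
    fun hf j i => by rw [Nat.add_assoc, hf, hf, Nat.add_assoc]
  induction W generalizing p q o with
  | weight k => by_cases hk : k = 0 <;> simp [compile, hk]
  | label m => simp [compile]
  | add U V hU hV =>
    rw [compile, List.map_append, hU p q o hf, hV p q _ (shift hf _), hf]
    rfl
  | mul U V hU hV =>
    rw [compile, List.map_append, hU p o _ (shift hf 1), hV o q _ (shift (shift hf 1) _),
      shift hf 1, hf 1]
    rfl
  | star U hU =>
    rw [compile, List.map_append, hU o o _ (shift hf 1), hf 1]
    rfl

theorem map_rename_compile (W : WExpr ℕ ℕ) (p q o : ℕ) :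
    (W.compile 0 1 2).map (rename (p, q, o)) = W.compile p q o := by
  have h0 : renameState (p, q, o) 0 = p := rfl
  have h1 : renameState (p, q, o) 1 = q := rfl
  have h2 : renameState (p, q, o) 2 = o := by simp [renameState]
  have h := map_compile (renameState (p, q, o)) W 0 1 2 fun i => by
    rw [h2, renameState, if_neg (by omega), if_neg (by omega), Nat.add_sub_cancel_left,
      Nat.add_comm]
  rw [h0, h1, h2] at h
  exact h

/-- The number of interior states and the transitions of the automaton of an expression. -/
def sizeCompile (W : WExpr ℕ ℕ) : ℕ × List Entry := (W.size, W.compile 0 1 2)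

/-- One step of the computation of `sizeCompile`, from the list of its values at the expressions
with a smaller encoding. -/
def sizeCompileStep (l : List (ℕ × List Entry)) : ℕ × List Entry :=
  let m := l.length / 5
  let a := l.getD m.unpair.1 (0, [])
  let b := l.getD m.unpair.2 (0, [])
  let c := l.getD m (0, [])
  if l.length % 5 = 0 then (1, if m = 0 then [] else [(0, 0, m, 2), (2, 0, 1, 1)])
  else if l.length % 5 = 1 then (1, [(0, m, 1, 2), (2, 0, 1, 1)])
  else if l.length % 5 = 2 then (a.1 + b.1, a.2 ++ b.2.map (rename (0, 1, 2 + a.1)))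
  else if l.length % 5 = 3 then
    (a.1 + b.1 + 1, a.2.map (rename (0, 2, 3)) ++ b.2.map (rename (2, 1, 3 + a.1)))
  else (c.1 + 1, [(0, 0, 1, 2), (2, 0, 1, 1)] ++ c.2.map (rename (2, 2, 3)))

/-- The expression with a given encoding. -/
noncomputable def ofNat : ℕ → WExpr ℕ ℕ :=
  (Equiv.ofBijective toNat ⟨toNat_injective, toNat_surjective⟩).symm

theorem ofNat_toNat (W : WExpr ℕ ℕ) : ofNat W.toNat = W :=
  Equiv.ofBijective_symm_apply_apply _ _ W

theorem sizeCompileStep_eq (n : ℕ) :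
    sizeCompileStep ((List.range n).map fun i => (ofNat i).sizeCompile) =
      (ofNat n).sizeCompile := by
  obtain ⟨W, rfl⟩ := toNat_surjective n
  have hget : ∀ U : WExpr ℕ ℕ, U.toNat < W.toNat →
      ((List.range W.toNat).map fun i => (ofNat i).sizeCompile).getD U.toNat (0, []) =
        U.sizeCompile := fun U hU => by
    simp [List.getD_eq_getElem?_getD, hU, ofNat_toNat]
  rw [ofNat_toNat]
  simp only [sizeCompileStep, List.length_map, List.length_range]
  cases W with
  | weight k =>
    have h1 : (weight k : WExpr ℕ ℕ).toNat % 5 = 0 := by simp only [toNat]; omega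
    have h2 : (weight k : WExpr ℕ ℕ).toNat / 5 = k := by simp only [toNat]; omega
    simp [h1, h2, sizeCompile, size, compile]
  | label m =>
    have h1 : (label m : WExpr ℕ ℕ).toNat % 5 = 1 := by simp only [toNat]; omega
    have h2 : (label m : WExpr ℕ ℕ).toNat / 5 = m := by simp only [toNat]; omega
    simp [h1, h2, sizeCompile, size, compile]
  | add U V =>
    have h1 : (add U V).toNat % 5 = 2 := by simp only [toNat]; omega
    have h2 : (add U V).toNat / 5 = Nat.pair U.toNat V.toNat := by simp only [toNat]; omega
    have hU := Nat.left_le_pair U.toNat V.toNat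
    have hV := Nat.right_le_pair U.toNat V.toNat
    rw [h1, h2, Nat.unpair_pair, hget U (by simp only [toNat]; omega),
      hget V (by simp only [toNat]; omega)]
    simp [sizeCompile, size, compile, map_rename_compile]
  | mul U V =>
    have h1 : (mul U V).toNat % 5 = 3 := by simp only [toNat]; omega
    have h2 : (mul U V).toNat / 5 = Nat.pair U.toNat V.toNat := by simp only [toNat]; omega
    have hU := Nat.left_le_pair U.toNat V.toNat
    have hV := Nat.right_le_pair U.toNat V.toNat
    rw [h1, h2, Nat.unpair_pair, hget U (by simp only [toNat]; omega),
      hget V (by simp only [toNat]; omega)]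
    simp [sizeCompile, size, compile, map_rename_compile]
  | star U =>
    have h1 : (star U).toNat % 5 = 4 := by simp only [toNat]; omega
    have h2 : (star U).toNat / 5 = U.toNat := by simp only [toNat]; omega
    rw [h1, h2, hget U (by simp only [toNat]; omega)]
    simp [sizeCompile, size, compile, map_rename_compile]

open Primrec

theorem primrec_renameState : Primrec₂ renameState :=
  Primrec.ite (Primrec.eq.comp snd (const 0)) (fst.comp fst)
    (Primrec.ite (Primrec.eq.comp snd (const 1)) (fst.comp (snd.comp fst))
      (nat_add.comp (nat_sub.comp snd (const 2)) (snd.comp (snd.comp fst))))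

theorem primrec_rename : Primrec₂ rename :=
  pair (primrec_renameState.comp fst (fst.comp snd)) (pair (fst.comp (snd.comp snd))
    (pair (fst.comp (snd.comp (snd.comp snd)))
      (primrec_renameState.comp fst (snd.comp (snd.comp (snd.comp snd))))))

theorem primrec_map_rename {α : Type*} [Primcodable α] {x : α → ℕ × ℕ × ℕ} {l : α → List Entry}
    (hx : Primrec x) (hl : Primrec l) : Primrec fun a => (l a).map (rename (x a)) :=
  list_map hl (primrec_rename.comp (hx.comp fst) snd)

theorem primrec_sizeCompileStep : Primrec sizeCompileStep := by
  have hn : Primrec fun l : List (ℕ × List Entry) => l.length := list_length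
  have hm : Primrec fun l : List (ℕ × List Entry) => l.length / 5 := nat_div.comp hn (const 5)
  have hr : ∀ r, PrimrecPred fun l : List (ℕ × List Entry) => l.length % 5 = r := fun r =>
    Primrec.eq.comp (nat_mod.comp hn (const 5)) (const r)
  have hget : ∀ {f : List (ℕ × List Entry) → ℕ}, Primrec f →
      Primrec fun l : List (ℕ × List Entry) => l.getD (f l) (0, []) := fun hf =>
    (list_getD _).comp .id hf
  have ha := hget (fst.comp (unpair.comp hm))
  have hb := hget (snd.comp (unpair.comp hm))
  have hc := hget hm
  have hentry : ∀ {f g : List (ℕ × List Entry) → ℕ}, Primrec f → Primrec g →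
      Primrec fun l => [((0, f l, g l, 2) : Entry), (2, 0, 1, 1)] := fun hf hg =>
    list_cons.comp (pair (const 0) (pair hf (pair hg (const 2)))) (const _)
  refine Primrec.ite (hr 0) (pair (const 1) (Primrec.ite (Primrec.eq.comp hm (const 0)) (const [])
      (hentry (const 0) hm)))
    (Primrec.ite (hr 1) (pair (const 1) (hentry hm (const 1)))
    (Primrec.ite (hr 2) (pair (nat_add.comp (fst.comp ha) (fst.comp hb))
      (list_append.comp (snd.comp ha) (primrec_map_rename (pair (const 0) (pair (const 1)
        (nat_add.comp (const 2) (fst.comp ha)))) (snd.comp hb))))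
    (Primrec.ite (hr 3) (pair (nat_add.comp (nat_add.comp (fst.comp ha) (fst.comp hb)) (const 1))
      (list_append.comp (primrec_map_rename (const _) (snd.comp ha))
        (primrec_map_rename (pair (const 2) (pair (const 1)
          (nat_add.comp (const 3) (fst.comp ha)))) (snd.comp hb))))
    (pair (nat_add.comp (fst.comp hc) (const 1))
      (list_append.comp (const _) (primrec_map_rename (const _) (snd.comp hc)))))))

theorem primrec_toAut : Primrec toAut := by
  have h1 : Primrec₂ fun (_ : Unit) n => (ofNat n).sizeCompile :=
    nat_strong_rec _ (g := fun _ l => some (sizeCompileStep l))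
      (option_some.comp (primrec_sizeCompileStep.comp snd)).to₂
      fun _ n => congrArg some (sizeCompileStep_eq n)
  have h2 : Primrec sizeCompile :=
    (h1.comp (const ()) Primrec.encode).of_eq fun W => congrArg sizeCompile (ofNat_toNat W)
  exact pair (nat_add.comp (const 2) (fst.comp h2)) (pair (const [0])
    (pair (snd.comp h2) (const [1])))

end WExpr

/-! ### Runs of automata as words of entries -/

namespace WAutomaton

variable {K M Q : Type*} [Finite Q]

/-- A presentation of an automaton by a code, with states numbered by `e` and entries chosen by
`g`, identifies the accepting runs with the accepted words of the code. -/
theorem isSemantics_iff_hasSeries [Semiring K] [RationallyAdditive K] [Monoid M] {κ : ℕ → K}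
    {μ : ℕ → M} (A : WAutomaton K M Q) (c : AutomatonCode) {e : Q → ℕ} (he : Function.Injective e)
    {g : Q × M × K × Q → Entry}
    (hg : ∀ t ∈ A.trans, (g t).1 = e t.1 ∧ (g t).2.2.2 = e t.2.2.2 ∧ μ (g t).2.1 = t.2.1 ∧
      κ (g t).2.2.1 = t.2.2.1)
    (hD : ∀ t, t ∈ c.entries ↔ ∃ t' ∈ A.trans, g t' = t) (hI : ∀ x, x ∈ A.init ↔ e x ∈ c.2.1)
    (hF : ∀ x, x ∈ A.final ↔ e x ∈ c.2.2.2) (s : M → K) :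
    A.IsSemantics s ↔ HasSeries (fun w : c.acceptedWords => wordVal κ μ w.1) s := by
  have hval : ∀ w : List (Q × M × K × Q), (∀ t ∈ w, t ∈ A.trans) →
      wordVal κ μ (w.map g) = (runLabel w, runWeight w) := by
    intro w hw
    induction w with
    | nil => rfl
    | cons t w ih =>
      obtain ⟨-, -, h1, h2⟩ := hg t (hw t (by simp))
      rw [List.map_cons, wordVal_cons, ih fun t ht => hw t (by simp [ht]), h1, h2]
      simp [runLabel, runWeight]
  have hpath : ∀ w : List (Q × M × K × Q), (∀ t ∈ w, t ∈ A.trans) → ∀ p q,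
      (IsPath c.entries Set.univ p (w.map g) q ↔ w.IsChain (fun t t' => t.2.2.2 = t'.1) ∧
        (∃ t ∈ w.head?, e t.1 = p) ∧ ∃ t ∈ w.getLast?, e t.2.2.2 = q) := by
    intro w hw p q
    induction w generalizing p with
    | nil => exact iff_of_false (fun h => h.ne_nil rfl) (by simp)
    | cons t w ih =>
      have ht : t ∈ A.trans := hw t (by simp)
      have ih' := ih fun t ht => hw t (by simp [ht])
      obtain ⟨h1, h2, -⟩ := hg t ht
      have htc := (hD (g t)).2 ⟨t, ht, rfl⟩
      cases w with
      | nil =>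
        constructor
        · rintro (⟨_, hp, hq⟩ | ⟨_, _, _, hw⟩)
          · simp [← hp, ← hq, h1, h2]
          · exact (hw.ne_nil rfl).elim
        · rintro ⟨-, hp, hq⟩
          exact .single htc (by simpa [h1] using hp) (by simpa [h2] using hq)
      | cons t' w =>
        rw [List.isChain_cons_cons]
        constructor
        · rintro (_ | ⟨_, hp, _, hw⟩)
          obtain ⟨h3, h4, h5⟩ := (ih' _).1 hw
          simp only [List.head?_cons, Option.mem_some_iff, exists_eq_left', h2] at h4
          exact ⟨⟨he h4.symm, h3⟩, by simp [← hp, h1], by simpa using h5⟩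
        · rintro ⟨⟨h3, h4⟩, h5, h6⟩
          refine .cons htc (by simpa [h1] using h5) trivial ((ih' _).2 ⟨h4, ?_, by simpa using h6⟩)
          simp [h2, h3]
  have hacc : ∀ w, A.IsAcceptingRun w ↔ (∀ t ∈ w, t ∈ A.trans) ∧ w.map g ∈ c.acceptedWords := by
    refine fun w => and_congr_right fun hw => ⟨?_, ?_⟩
    · rintro ⟨h, ⟨t, ht, hi⟩, t', ht', hf⟩
      exact ⟨_, (hI _).1 hi, _, (hF _).1 hf, (hpath w hw _ _).2 ⟨h, ⟨t, ht, rfl⟩, t', ht', rfl⟩⟩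
    · rintro ⟨p, hp, q, hq, h⟩
      obtain ⟨h', ⟨t, ht, rfl⟩, t', ht', rfl⟩ := (hpath w hw _ _).1 h
      exact ⟨h', ⟨t, ht, (hI _).2 hp⟩, t', ht', (hF _).2 hq⟩
  have hinj : ∀ w w' : List (Q × M × K × Q), (∀ t ∈ w, t ∈ A.trans) → (∀ t ∈ w', t ∈ A.trans) →
      w.map g = w'.map g → w = w' := by
    intro w
    induction w with
    | nil => intro w' _ _ h; exact (List.map_eq_nil_iff.1 h.symm).symm
    | cons t w ih =>
      intro w' hw hw' h
      cases w' with
      | nil => simp at h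
      | cons t' w' =>
        rw [List.map_cons, List.map_cons, List.cons.injEq] at h
        rw [ih w' (fun t ht => hw t (by simp [ht])) (fun t ht => hw' t (by simp [ht])) h.2]
        obtain ⟨h1, h2, h3, h4⟩ := hg t (hw t (by simp))
        obtain ⟨h1', h2', h3', h4'⟩ := hg t' (hw' t' (by simp))
        rw [h.1] at h1 h2 h3 h4
        rw [Prod.ext (he (h1.symm.trans h1')) (Prod.ext (h3.symm.trans h3')
          (Prod.ext (h4.symm.trans h4') (he (h2.symm.trans h2'))))]
  refine forall_congr' fun m => isCountableSum_embedding_iff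
    (g := fun w : {w : List (Q × M × K × Q) // A.IsAcceptingRun w ∧ runLabel w = m} =>
      (⟨⟨w.1.map g, ((hacc _).1 w.2.1).2⟩, by rw [hval _ w.2.1.1]; exact w.2.2⟩ :
        {w : c.acceptedWords // (wordVal κ μ w.1).1 = m}))
    (fun w w' h => ?_) (fun w => ?_) ?_
  · simp only [Subtype.mk.injEq] at h
    exact Subtype.ext (hinj _ _ w.2.1.1 w'.2.1.1 h)
  · exact (congrArg Prod.snd (hval _ w.2.1.1)).symm
  · rintro ⟨⟨v, hv⟩, hm⟩ hn
    obtain ⟨w, hw, rfl⟩ : ∃ w : List (Q × M × K × Q), (∀ t ∈ w, t ∈ A.trans) ∧ w.map g = v := by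
      obtain ⟨p, _, q, _, h⟩ := hv
      have := h.mem
      clear hn hm h
      induction v with
      | nil => exact ⟨[], by simp⟩
      | cons t v ih =>
        obtain ⟨w, hw, rfl⟩ := ih fun t ht => this t (List.mem_cons_of_mem _ ht)
        obtain ⟨t', ht', rfl⟩ := (hD _).1 (this t List.mem_cons_self)
        exact ⟨t' :: w, List.forall_mem_cons.2 ⟨ht', hw⟩, rfl⟩
    refine (hn ⟨⟨w, (hacc w).2 ⟨hw, hv⟩, ?_⟩, rfl⟩).elim
    rw [hval w hw] at hm
    exact hm

end WAutomaton

/-- Faithfulness excludes that two entries are merged into one transition, which would lose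
multiplicities. -/
theorem AutomatonCode.Faithful.isSemantics_iff {K M : Type*} [Semiring K] [RationallyAdditive K]
    [Monoid M] {κ : ℕ → K} {μ : ℕ → M} {c : AutomatonCode} (hc : c.Faithful κ μ) (s : M → K) :
    (c.toAutomaton κ μ).IsSemantics s ↔
      HasSeries (fun w : c.acceptedWords => wordVal κ μ w.1) s := by
  have hex : ∀ t : Fin c.1 × M × K × Fin c.1, ∃ t' : Entry, t ∈ (c.toAutomaton κ μ).trans →
      t' ∈ c.2.2.1 ∧ t'.1 = t.1 ∧ t'.2.2.2 = t.2.2.2 ∧ μ t'.2.1 = t.2.1 ∧ κ t'.2.2.1 = t.2.2.1 := by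
    intro t
    by_cases ht : t ∈ (c.toAutomaton κ μ).trans
    · obtain ⟨m, k, h, hm, hk⟩ := id ht
      exact ⟨(t.1, m, k, t.2.2.2), fun _ => ⟨h, rfl, rfl, hm.symm, hk.symm⟩⟩
    · exact ⟨(0, 0, 0, 0), fun h => (ht h).elim⟩
  choose g hg using hex
  refine WAutomaton.isSemantics_iff_hasSeries _ c Fin.val_injective (g := g)
    (fun t ht => (hg t ht).2) (fun t => ⟨?_, ?_⟩) (fun _ => Iff.rfl) (fun _ => Iff.rfl) s
  · rintro ⟨ht, h1, h2⟩
    have ht' : ((⟨t.1, h1⟩, μ t.2.1, κ t.2.2.1, ⟨t.2.2.2, h2⟩) : Fin c.1 × M × K × Fin c.1) ∈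
        (c.toAutomaton κ μ).trans := ⟨t.2.1, t.2.2.1, ht, rfl, rfl⟩
    obtain ⟨h3, h4, h5, h6, h7⟩ := hg _ ht'
    -- by faithfulness, the chosen entry is the given one
    exact ⟨_, ht', hc h3 ht (by simp only [h4, h5, h6, h7])⟩
  · rintro ⟨t, ht, rfl⟩
    obtain ⟨h3, h4, h5, -⟩ := hg t ht
    exact ⟨h3, h4 ▸ t.1.2, h5 ▸ t.2.2.2.2⟩

section

variable {K M : Type*} [Semiring K] [RationallyAdditive K] [Monoid M] {κ : ℕ → K} {μ : ℕ → M}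

/-- Over a pre-rational monoid, every expression is valid, and its semantics is the series of its
derivations. -/
theorem PreRational.isSemantics_map_iff (hM : PreRational M) (h0 : κ 0 = 0) (h1 : κ 1 = 1)
    (hμ : μ 0 = 1) (W : WExpr ℕ ℕ) (s : M → K) :
    (W.map κ μ).IsSemantics s ↔ HasSeries (WExpr.val κ μ W) s := by
  refine WExpr.isSemantics_map_iff κ μ h0 h1 (fun W => ?_) W s
  obtain ⟨s, hs⟩ := W.toAut.exists_hasSeries hM κ μ
  exact ⟨s, (represents_acceptedWords_toAut h1 hμ W).hasSeries_iff.2 hs⟩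

theorem PreRational.isSemantics_toExpr_iff (hM : PreRational M) (h0 : κ 0 = 0) (h1 : κ 1 = 1)
    (hμ : μ 0 = 1) (c : AutomatonCode) (s : M → K) :
    HasSeries (fun w : c.acceptedWords => wordVal κ μ w.1) s ↔
      (c.toExpr.map κ μ).IsSemantics s := by
  rw [hM.isSemantics_map_iff h0 h1 hμ, AutomatonCode.hasSeries_toExpr_iff h0]

theorem PreRational.isSemantics_toAut_iff (hM : PreRational M) (h0 : κ 0 = 0) (h1 : κ 1 = 1)
    (hμ : μ 0 = 1) (W : WExpr ℕ ℕ) (s : M → K) :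
    (W.map κ μ).IsSemantics s ↔ (W.toAut.toAutomaton κ μ).IsSemantics s := by
  rw [hM.isSemantics_map_iff h0 h1 hμ, (WExpr.faithful_toAut κ μ W).isSemantics_iff,
    (represents_acceptedWords_toAut h1 hμ W).hasSeries_iff]

/-! ### Presentations by numbers -/

theorem exists_forall_mem_range {K : Type*} [Semiring K] (l : List K) :
    ∃ κ : ℕ → K, κ 0 = 0 ∧ κ 1 = 1 ∧ ∀ k ∈ l, k ∈ Set.range κ := by
  refine ⟨fun n => (0 :: 1 :: l).getD n 0, rfl, rfl, fun k hk => ?_⟩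
  obtain ⟨n, hn, rfl⟩ := List.mem_iff_getElem.1 hk
  exact ⟨n + 2, by simp [hn]⟩

theorem exists_forall_mem_range' {M : Type*} [Monoid M] (l : List M) :
    ∃ μ : ℕ → M, μ 0 = 1 ∧ ∀ m ∈ l, m ∈ Set.range μ := by
  refine ⟨fun n => (1 :: l).getD n 1, rfl, fun m hm => ?_⟩
  obtain ⟨n, hn, rfl⟩ := List.mem_iff_getElem.1 hm
  exact ⟨n + 1, by simp [hn]⟩

/-- Every expression is presented by an expression with numbers as atoms, for any representation
that reaches the finitely many weights and labels that occur. -/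
theorem WExpr.exists_map_eq {K M : Type*} (W : WExpr K M) :
    ∃ (k : List K) (m : List M), ∀ (κ : ℕ → K) (μ : ℕ → M), (∀ x ∈ k, x ∈ Set.range κ) →
      (∀ x ∈ m, x ∈ Set.range μ) → ∃ W' : WExpr ℕ ℕ, W'.map κ μ = W := by
  induction W with
  | weight k =>
    refine ⟨[k], [], fun κ μ hκ _ => ?_⟩
    obtain ⟨n, hn⟩ := hκ k (by simp)
    exact ⟨weight n, by rw [map, hn]⟩
  | label m =>
    refine ⟨[], [m], fun κ μ _ hμ => ?_⟩
    obtain ⟨n, hn⟩ := hμ m (by simp)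
    exact ⟨label n, by rw [map, hn]⟩
  | add U V hU hV =>
    obtain ⟨k, m, hU⟩ := hU
    obtain ⟨k', m', hV⟩ := hV
    refine ⟨k ++ k', m ++ m', fun κ μ hκ hμ => ?_⟩
    obtain ⟨U', rfl⟩ := hU κ μ (fun x hx => hκ x (by simp [hx])) fun x hx => hμ x (by simp [hx])
    obtain ⟨V', rfl⟩ := hV κ μ (fun x hx => hκ x (by simp [hx])) fun x hx => hμ x (by simp [hx])
    exact ⟨add U' V', rfl⟩
  | mul U V hU hV =>
    obtain ⟨k, m, hU⟩ := hU
    obtain ⟨k', m', hV⟩ := hV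
    refine ⟨k ++ k', m ++ m', fun κ μ hκ hμ => ?_⟩
    obtain ⟨U', rfl⟩ := hU κ μ (fun x hx => hκ x (by simp [hx])) fun x hx => hμ x (by simp [hx])
    obtain ⟨V', rfl⟩ := hV κ μ (fun x hx => hκ x (by simp [hx])) fun x hx => hμ x (by simp [hx])
    exact ⟨mul U' V', rfl⟩
  | star U hU =>
    obtain ⟨k, m, hU⟩ := hU
    refine ⟨k, m, fun κ μ hκ hμ => ?_⟩
    obtain ⟨U', rfl⟩ := hU κ μ hκ hμ
    exact ⟨star U', rfl⟩

/-- Every automaton is presented by a code, with a suitable representation of weights and labels by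
numbers. -/
theorem WAutomaton.exists_code {Q : Type*} [Finite Q] (A : WAutomaton K M Q) :
    ∃ (κ : ℕ → K) (μ : ℕ → M) (c : AutomatonCode), κ 0 = 0 ∧ κ 1 = 1 ∧ μ 0 = 1 ∧
      ∀ s, A.IsSemantics s ↔ HasSeries (fun w : c.acceptedWords => wordVal κ μ w.1) s := by
  classical
  have := Fintype.ofFinite Q
  let T := A.trans_finite.toFinset.toList
  have hT : ∀ t, t ∈ T ↔ t ∈ A.trans := fun t => by simp [T]
  obtain ⟨κ, h0, h1, hκ⟩ := exists_forall_mem_range (T.map fun t => t.2.2.1)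
  obtain ⟨μ, hμ0, hμ⟩ := exists_forall_mem_range' (T.map fun t => t.2.1)
  let e : Q → ℕ := fun x => Fintype.equivFin Q x
  have he : Function.Injective e := Fin.val_injective.comp (Fintype.equivFin Q).injective
  let g : Q × M × K × Q → Entry := fun t =>
    (e t.1, Function.invFun μ t.2.1, Function.invFun κ t.2.2.1, e t.2.2.2)
  refine ⟨κ, μ, (Fintype.card Q, (Finset.univ.filter (· ∈ A.init)).toList.map e, T.map g,
    (Finset.univ.filter (· ∈ A.final)).toList.map e), h0, h1, hμ0, fun s =>
    A.isSemantics_iff_hasSeries _ he (g := g) (fun t ht => ⟨rfl, rfl, ?_, ?_⟩) (fun t => ?_)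
      (fun x => ?_) (fun x => ?_) s⟩
  · exact Function.invFun_eq (hμ _ (List.mem_map.2 ⟨t, (hT t).2 ht, rfl⟩))
  · exact Function.invFun_eq (hκ _ (List.mem_map.2 ⟨t, (hT t).2 ht, rfl⟩))
  · simp only [AutomatonCode.entries, Set.mem_ofPred_eq, List.mem_map, hT]
    constructor
    · exact fun h => h.1
    · rintro ⟨t, ht, rfl⟩
      exact ⟨⟨t, ht, rfl⟩, Fin.is_lt _, Fin.is_lt _⟩
  · simp [he.eq_iff]
  · simp [he.eq_iff]

end

theorem mainTheorem1 :
    -- a series is the semantics of an automaton iff it is the semantics of an expression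
    (∀ (K : Type u) [Semiring K] [RationallyAdditive K] (M : Type v) [Monoid M],
      PreRational M → ∀ s : M → K,
        ((∃ (Q : Type) (_ : Finite Q) (A : WAutomaton K M Q), A.IsSemantics s) ↔
          ∃ W : WExpr K M, W.IsSemantics s)) ∧
    -- there is an algorithm from automata to equivalent expressions
    (∃ toExpr : AutomatonCode → WExpr ℕ ℕ, Computable toExpr ∧
      ∀ (K : Type u) [Semiring K] [RationallyAdditive K] (M : Type v) [Monoid M],
        PreRational M → ∀ (κ : ℕ → K) (μ : ℕ → M), κ 0 = 0 → κ 1 = 1 → μ 0 = 1 →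
          ∀ c : AutomatonCode, c.Faithful κ μ → ∀ s : M → K,
            ((c.toAutomaton κ μ).IsSemantics s ↔ ((toExpr c).map κ μ).IsSemantics s)) ∧
    -- there is an algorithm from expressions to equivalent automata
    (∃ toAut : WExpr ℕ ℕ → AutomatonCode, Computable toAut ∧
      ∀ (K : Type u) [Semiring K] [RationallyAdditive K] (M : Type v) [Monoid M],
        PreRational M → ∀ (κ : ℕ → K) (μ : ℕ → M), κ 0 = 0 → κ 1 = 1 → μ 0 = 1 →
          ∀ (W : WExpr ℕ ℕ) (s : M → K),
            ((W.map κ μ).IsSemantics s ↔ ((toAut W).toAutomaton κ μ).IsSemantics s)) := by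
  refine ⟨fun K _ _ M _ hM s => ⟨?_, ?_⟩,
    ⟨_, AutomatonCode.primrec_toExpr.to_comp, fun K _ _ M _ hM κ μ h0 h1 hμ c hc s =>
      (hc.isSemantics_iff s).trans (hM.isSemantics_toExpr_iff h0 h1 hμ c s)⟩,
    ⟨_, WExpr.primrec_toAut.to_comp, fun K _ _ M _ hM κ μ h0 h1 hμ W s =>
      hM.isSemantics_toAut_iff h0 h1 hμ W s⟩⟩
  · rintro ⟨Q, _, A, hA⟩
    obtain ⟨κ, μ, c, h0, h1, hμ, hc⟩ := A.exists_code
    exact ⟨_, (hM.isSemantics_toExpr_iff h0 h1 hμ c s).1 ((hc s).1 hA)⟩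
  · rintro ⟨W, hW⟩
    obtain ⟨k, m, h⟩ := W.exists_map_eq
    obtain ⟨κ, h0, h1, hκ⟩ := exists_forall_mem_range k
    obtain ⟨μ, hμ0, hμ⟩ := exists_forall_mem_range' m
    obtain ⟨W, rfl⟩ := h κ μ hκ hμ
    exact ⟨_, inferInstance, _, (hM.isSemantics_toAut_iff h0 h1 hμ0 W s).1 hW⟩
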